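/- For $u,v\in\mathbb C^2$ write $|u,v|=u_1v_2-u_2v_1$. Fix $\mathbf p=(p_1,p_2)\in\mathbb C^2$. Let $\widetilde L(\mathbf p)$ be the complex Lie algebra spanned by $t^{\mathbf m}$, $E(\mathbf m)$ ($\mathbf m\in\mathbb Z^2$), $\partial_1,\partial_2$ subject to $$[t^{\mathbf m},t^{\mathbf n}]=0,\quad [t^{\mathbf m},E(\mathbf n)]=-|\mathbf m+\mathbf p,\mathbf n+\mathbf p|\,t^{\mathbf m+\mathbf n},\quad [E(\mathbf m),E(\mathbf n)]=-|\mathbf m+\mathbf p,\mathbf n+\mathbf p|\,E(\mathbf m+\mathbf n),$$ $$[\partial_i,E(\mathbf m)]=m_iE(\mathbf m),\quad [\partial_i,t^{\mathbf m}]=(m_i+p_i)t^{\mathbf m},\quad [\partial_1,\partial_2]=0,\quad E(\mathbf 0)=p_2\partial_1-p_1\partial_2,$$ let $L(\mathbf p)\subset\widetilde L(\mathbf p)$ be the subalgebra spanned by all $t^{\mathbf m}$ and $E(\mathbf m)$, and let $\mathfrak h=\mathbb C\partial_1\oplus\mathbb C\partial_2$, so that $U(\mathfrak h)=\mathbb C[\partial_1,\partial_2]$.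 An $L(\mathbf p)$-module is said to be free of rank one over $U(\mathfrak h)$ if it is equipped with an action of $\mathfrak h$ that makes it a free $U(\mathfrak h)$-module of rank one, has the commutators with $t^{\mathbf m}$, $E(\mathbf m)$ displayed above, and agrees with the action of $L(\mathbf p)$ on $E(\mathbf 0)=p_2\partial_1-p_1\partial_2$; isomorphisms of such modules commute with $L(\mathbf p)$ and with $\mathfrak h$. Let $V$ be an $\widetilde L(\mathbf p)$-module or an $L(\mathbf p)$-module that is free of rank one over $U(\mathfrak h)$. For $\boldsymbol\lambda\in(\mathbb C^\times)^2$ put $\boldsymbol\lambda^{\mathbf m}=\lambda_1^{m_1}\lambda_2^{m_2}$. (1) If $\mathbf p\neq(0,0)$, then $V\cong\Omega(\boldsymbol\lambda,\alpha,b_{\mathbf 0})$ for some $\boldsymbol\lambda\in(\mathbb C^\times)^2$, $\alpha\in\mathbb C$, $b_{\mathbf 0}\in\mathbb C$, where $\Omega(\boldsymbol\lambda,\alpha,b_{\mathbf 0})=\mathbb C[\partial_1,\partial_2]$, with $\partial_1,\partial_2$ acting by multiplication and $$E(\mathbf m)f(\boldsymbol\partial)=\boldsymbol\lambda^{\mathbf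 m}\big[(m_2+p_2)(\partial_1+p_1\alpha)-(m_1+p_1)(\partial_2+p_2\alpha)\big]f(\boldsymbol\partial-\mathbf m),\qquad t^{\mathbf m}f(\boldsymbol\partial)=\boldsymbol\lambda^{\mathbf m}b_{\mathbf 0}\,f(\boldsymbol\partial-\mathbf m-\mathbf p).$$ In particular, when $b_{\mathbf 0}=0$ all $t^{\mathbf m}$ act on $V$ as zero, so that $V$ is just a module over the subalgebra spanned by the $E(\mathbf m)$ (respectively by the $E(\mathbf m)$ and $\partial_1,\partial_2$). (2) If $\mathbf p=(0,0)$ and not all $E(\mathbf m)$ act on $V$ as zero, then $V\cong\Omega(\boldsymbol\lambda,\boldsymbol\beta,b_{\mathbf 0},k)$ for some $\boldsymbol\lambda\in(\mathbb C^\times)^2$, $\boldsymbol\beta\in\mathbb C^2$, $b_{\mathbf 0},k\in\mathbb C$, where $\Omega(\boldsymbol\lambda,\boldsymbol\beta,b_{\mathbf 0},k)=\mathbb C[\partial_1,\partial_2]$, with $\partial_1,\partial_2$ acting by multiplication and $$E(\mathbf m)f(\boldsymbol\partial)=\boldsymbol\lambda^{\mathbf m}\big(m_2(\partial_1+\beta_1)-m_1(\partial_2+\beta_2)\big)f(\boldsymbol\partial-\mathbf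 m),\qquad t^{\mathbf m}f(\boldsymbol\partial)=\begin{cases}\boldsymbol\lambda^{\mathbf m}k\,f(\boldsymbol\partial-\mathbf m),&\mathbf m\ne\mathbf 0,\\ b_{\mathbf 0}f(\boldsymbol\partial),&\mathbf m=\mathbf 0.\end{cases}$$ -/

import Mathlib

noncomputable section

namespace HeisVir

attribute [local instance 100] LieRing.ofAssociativeRing

/-- The polynomial algebra `ℂ[∂₁, ∂₂]`, which is the enveloping algebra `U(𝔥)` of the
abelian Lie algebra `𝔥 = ℂ∂₁ ⊕ ℂ∂₂`. The variable `X 0` is `∂₁` and `X 1` is `∂₂`. -/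
abbrev Uh : Type := MvPolynomial (Fin 2) ℂ

/-- The determinant of the `2 × 2` matrix with rows `u` and `v`. -/
def det2 (u v : Fin 2 → ℂ) : ℂ := u 0 * v 1 - u 1 * v 0

/-- A vector of integers regarded as a vector of complex numbers. -/
def toC (m : Fin 2 → ℤ) : Fin 2 → ℂ := fun i => (m i : ℂ)

/-- The generators `t^m`, `E(m)` (for `m ∈ ℤ²`), `∂₁`, `∂₂` of the extended algebra. -/
inductive Gen : Type
  | t (m : Fin 2 → ℤ)
  | E (m : Fin 2 → ℤ)
  | d (i : Fin 2)

/-- The defining relations: `Rel p x y` says that `x = y` is imposed. -/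
inductive Rel (p : Fin 2 → ℂ) : FreeLieAlgebra ℂ Gen → FreeLieAlgebra ℂ Gen → Prop
  | tt (m n : Fin 2 → ℤ) :
      Rel p ⁅FreeLieAlgebra.of ℂ (Gen.t m), FreeLieAlgebra.of ℂ (Gen.t n)⁆ 0
  | tE (m n : Fin 2 → ℤ) :
      Rel p ⁅FreeLieAlgebra.of ℂ (Gen.t m), FreeLieAlgebra.of ℂ (Gen.E n)⁆
        ((-det2 (toC m + p) (toC n + p)) • FreeLieAlgebra.of ℂ (Gen.t (m + n)))
  | EE (m n : Fin 2 → ℤ) :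
      Rel p ⁅FreeLieAlgebra.of ℂ (Gen.E m), FreeLieAlgebra.of ℂ (Gen.E n)⁆
        ((-det2 (toC m + p) (toC n + p)) • FreeLieAlgebra.of ℂ (Gen.E (m + n)))
  | dE (i : Fin 2) (m : Fin 2 → ℤ) :
      Rel p ⁅FreeLieAlgebra.of ℂ (Gen.d i), FreeLieAlgebra.of ℂ (Gen.E m)⁆
        ((m i : ℂ) • FreeLieAlgebra.of ℂ (Gen.E m))
  | dt (i : Fin 2) (m : Fin 2 → ℤ) :
      Rel p ⁅FreeLieAlgebra.of ℂ (Gen.d i), FreeLieAlgebra.of ℂ (Gen.t m)⁆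
        (((m i : ℂ) + p i) • FreeLieAlgebra.of ℂ (Gen.t m))
  | dd (i j : Fin 2) :
      Rel p ⁅FreeLieAlgebra.of ℂ (Gen.d i), FreeLieAlgebra.of ℂ (Gen.d j)⁆ 0
  /-- The identification `E(0) = p₂∂₁ - p₁∂₂`. -/
  | E_zero :
      Rel p (FreeLieAlgebra.of ℂ (Gen.E 0))
        (p 1 • FreeLieAlgebra.of ℂ (Gen.d 0) - p 0 • FreeLieAlgebra.of ℂ (Gen.d 1))

/-- The ideal of the free Lie algebra generated by the relations. -/
def relIdeal (p : Fin 2 → ℂ) : LieIdeal ℂ (FreeLieAlgebra ℂ Gen) :=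
  LieSubmodule.lieSpan ℂ (FreeLieAlgebra ℂ Gen) {z | ∃ x y, Rel p x y ∧ z = x - y}

/-- The Lie algebra `L̃(p)`, generated by `t^m`, `E(m)`, `∂₁`, `∂₂` subject to the relations
`Rel p`. -/
abbrev Ltilde (p : Fin 2 → ℂ) : Type := FreeLieAlgebra ℂ Gen ⧸ relIdeal p

/-- The element `t^m` of `L̃(p)`. -/
def tElt (p : Fin 2 → ℂ) (m : Fin 2 → ℤ) : Ltilde p :=
  LieSubmodule.Quotient.mk (FreeLieAlgebra.of ℂ (Gen.t m))

/-- The element `E(m)` of `L̃(p)`. -/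
def EElt (p : Fin 2 → ℂ) (m : Fin 2 → ℤ) : Ltilde p :=
  LieSubmodule.Quotient.mk (FreeLieAlgebra.of ℂ (Gen.E m))

/-- The element `∂ᵢ` of `L̃(p)`. -/
def dElt (p : Fin 2 → ℂ) (i : Fin 2) : Ltilde p :=
  LieSubmodule.Quotient.mk (FreeLieAlgebra.of ℂ (Gen.d i))

/-- The Lie subalgebra `L(p)` of `L̃(p)` generated by all `t^m` and `E(m)`. By the relations it is
their linear span. -/
def Lalg (p : Fin 2 → ℂ) : LieSubalgebra ℂ (Ltilde p) :=
  LieSubalgebra.lieSpan ℂ (Ltilde p) (Set.range (tElt p) ∪ Set.range (EElt p))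

/-- The element `t^m` of `L(p)`. -/
def tL (p : Fin 2 → ℂ) (m : Fin 2 → ℤ) : Lalg p :=
  ⟨tElt p m, LieSubalgebra.subset_lieSpan (Or.inl ⟨m, rfl⟩)⟩

/-- The element `E(m)` of `L(p)`. -/
def EL (p : Fin 2 → ℂ) (m : Fin 2 → ℤ) : Lalg p :=
  ⟨EElt p m, LieSubalgebra.subset_lieSpan (Or.inr ⟨m, rfl⟩)⟩

/-- `V`, with `∂ᵢ` acting as `D i`, is free of rank one over `U(𝔥) = ℂ[∂₁, ∂₂]`. (The module
structure below exists only if `D 0` and `D 1` commute, and it is then determined by `D`.) -/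
def UhFreeRankOne {V : Type*} [AddCommGroup V] [Module ℂ V] (D : Fin 2 → Module.End ℂ V) : Prop :=
  ∃ _ : Module Uh V,
    (∀ (c : ℂ) (v : V), (MvPolynomial.C c : Uh) • v = c • v) ∧
    (∀ (i : Fin 2) (v : V), (MvPolynomial.X i : Uh) • v = D i v) ∧
    Module.Free Uh V ∧ Module.finrank Uh V = 1

/-- An action of `𝔥` on an `L(p)`-module `V` that is compatible with the action of `L(p)`:
`∂ᵢ` acts as `D i`, the commutators with `E(m)` and `t^m` are the ones in `L̃(p)`, and the element
`E(0) = p₂∂₁ - p₁∂₂` which lies in both `L(p)` and `𝔥` acts in the same way. -/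
structure HAction (p : Fin 2 → ℂ) {V : Type*} [AddCommGroup V] [Module ℂ V]
    [LieRingModule (Lalg p) V] [LieModule ℂ (Lalg p) V] (D : Fin 2 → Module.End ℂ V) : Prop where
  comm : ∀ v, D 0 (D 1 v) = D 1 (D 0 v)
  lie_E : ∀ i m v, D i ⁅EL p m, v⁆ - ⁅EL p m, D i v⁆ = (m i : ℂ) • ⁅EL p m, v⁆
  lie_t : ∀ i m v, D i ⁅tL p m, v⁆ - ⁅tL p m, D i v⁆ = ((m i : ℂ) + p i) • ⁅tL p m, v⁆
  E_zero : ∀ v, ⁅EL p 0, v⁆ = p 1 • D 0 v - p 0 • D 1 v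

/-! ### Representations of `L̃(p)` from operators satisfying the relations -/

/-- The universal property of `L̃(p)`. -/
def liftL (p : Fin 2 → ℂ) {A : Type*} [LieRing A] [LieAlgebra ℂ A] (f : Gen → A)
    (hf : ∀ x y, Rel p x y → FreeLieAlgebra.lift ℂ f x = FreeLieAlgebra.lift ℂ f y) :
    Ltilde p →ₗ⁅ℂ⁆ A :=
  { (relIdeal p).toSubmodule.liftQ (FreeLieAlgebra.lift ℂ f : FreeLieAlgebra ℂ Gen →ₗ[ℂ] A) (by
      have h : relIdeal p ≤ (FreeLieAlgebra.lift ℂ f).ker := by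
        refine LieSubmodule.lieSpan_le.2 ?_
        rintro _ ⟨x, y, hxy, rfl⟩
        simp [LieHom.mem_ker, hf x y hxy]
      intro x hx
      exact (FreeLieAlgebra.lift ℂ f).mem_ker.1 (h hx)) with
    map_lie' := by
      intro x y
      induction x using Submodule.Quotient.induction_on with | _ x =>
      induction y using Submodule.Quotient.induction_on with | _ y =>
      exact (FreeLieAlgebra.lift ℂ f).map_lie x y }

theorem liftL_mk (p : Fin 2 → ℂ) {A : Type*} [LieRing A] [LieAlgebra ℂ A] (f : Gen → A)
    (hf : ∀ x y, Rel p x y → FreeLieAlgebra.lift ℂ f x = FreeLieAlgebra.lift ℂ f y) (g : Gen) :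
    liftL p f hf (LieSubmodule.Quotient.mk (FreeLieAlgebra.of ℂ g)) = f g :=
  FreeLieAlgebra.lift_of_apply f g

/-! ### The modules `Ω` -/

/-- The translation `f(∂) ↦ f(∂ - a)`. -/
def shift (a : Fin 2 → ℂ) : Uh →ₐ[ℂ] Uh :=
  MvPolynomial.aeval fun i => MvPolynomial.X i - MvPolynomial.C (a i)

/-- The scalar `λ₁^{m₁} λ₂^{m₂}`. -/
def lamPow (lam : Fin 2 → ℂˣ) (m : Fin 2 → ℤ) : ℂ := ((lam 0 ^ m 0 * lam 1 ^ m 1 : ℂˣ) : ℂ)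

/-- The operator `f ↦ g · f(∂ - a)` on `ℂ[∂₁, ∂₂]`. -/
def mulShift (g : Uh) (a : Fin 2 → ℂ) : Module.End ℂ Uh :=
  LinearMap.mulLeft ℂ g ∘ₗ (shift a).toLinearMap

/-- The linear polynomial `u₂(∂₁ + r₁) - u₁(∂₂ + r₂)`. -/
def linPoly (u r : Fin 2 → ℂ) : Uh :=
  MvPolynomial.C (u 1) * (MvPolynomial.X 0 + MvPolynomial.C (r 0)) -
    MvPolynomial.C (u 0) * (MvPolynomial.X 1 + MvPolynomial.C (r 1))

/-- The operators defining `Ω(λ, α, b₀)`. -/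
def omegaOp (p : Fin 2 → ℂ) (lam : Fin 2 → ℂˣ) (α b : ℂ) : Gen → Module.End ℂ Uh
  | Gen.t m => mulShift (MvPolynomial.C (lamPow lam m * b)) (toC m + p)
  | Gen.E m => mulShift (MvPolynomial.C (lamPow lam m) * linPoly (toC m + p) (α • p)) (toC m)
  | Gen.d i => LinearMap.mulLeft ℂ (MvPolynomial.X i)

/-- The operators defining `Ω(λ, β, b₀, k)`. -/
def omegaZeroOp (lam : Fin 2 → ℂˣ) (β : Fin 2 → ℂ) (b k : ℂ) : Gen → Module.End ℂ Uh
  | Gen.t m => if m = 0 then mulShift (MvPolynomial.C b) 0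
      else mulShift (MvPolynomial.C (lamPow lam m * k)) (toC m)
  | Gen.E m => mulShift (MvPolynomial.C (lamPow lam m) * linPoly (toC m) β) (toC m)
  | Gen.d i => LinearMap.mulLeft ℂ (MvPolynomial.X i)

theorem shift_shift (a b : Fin 2 → ℂ) (f : Uh) : shift a (shift b f) = shift (a + b) f := by
  have : (shift a).comp (shift b) = shift (a + b) := by
    ext i
    simp [shift]
    ring
  exact DFunLike.congr_fun this f

theorem shift_zero (f : Uh) : shift 0 f = f := by
  simp [shift]

theorem shift_C (a : Fin 2 → ℂ) (c : ℂ) : shift a (MvPolynomial.C c) = MvPolynomial.C c :=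
  (shift a).commutes c

theorem shift_linPoly (a u r : Fin 2 → ℂ) :
    shift a (linPoly u r) = linPoly u r + MvPolynomial.C (det2 u a) := by
  simp only [linPoly, map_sub, map_mul, map_add, shift_C, det2]
  simp only [shift, MvPolynomial.aeval_X]
  ring

theorem mulShift_apply (g : Uh) (a : Fin 2 → ℂ) (f : Uh) : mulShift g a f = g * shift a f := rfl

theorem lamPow_add (lam : Fin 2 → ℂˣ) (m n : Fin 2 → ℤ) :
    lamPow lam (m + n) = lamPow lam m * lamPow lam n := by
  simp only [lamPow, Pi.add_apply, zpow_add, ← Units.val_mul]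
  congr 1
  exact mul_mul_mul_comm _ _ _ _

theorem toC_add (m n : Fin 2 → ℤ) : toC (m + n) = toC m + toC n := by
  ext i; simp [toC]

theorem lamPow_zero (lam : Fin 2 → ℂˣ) : lamPow lam 0 = 1 := by simp [lamPow]

theorem toC_zero : toC 0 = 0 := by ext i; simp [toC]

theorem mulShift_lie (g h : Uh) (a b : Fin 2 → ℂ) :
    ⁅mulShift g a, mulShift h b⁆ = mulShift (g * shift a h - h * shift b g) (a + b) := by
  refine LinearMap.ext fun f => ?_
  rw [LieRing.of_associative_ring_bracket, LinearMap.sub_apply, Module.End.mul_apply,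
    Module.End.mul_apply]
  simp only [mulShift_apply, map_mul, shift_shift, add_comm b a]
  ring

theorem mulLeft_X_lie (i : Fin 2) (g : Uh) (a : Fin 2 → ℂ) :
    ⁅(LinearMap.mulLeft ℂ (MvPolynomial.X i) : Module.End ℂ Uh), mulShift g a⁆ =
      a i • mulShift g a := by
  refine LinearMap.ext fun f => ?_
  rw [LieRing.of_associative_ring_bracket, LinearMap.sub_apply, Module.End.mul_apply,
    Module.End.mul_apply, LinearMap.smul_apply, MvPolynomial.smul_eq_C_mul]
  have h : shift a (MvPolynomial.X i) = MvPolynomial.X i - MvPolynomial.C (a i) := by simp [shift]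
  simp only [mulShift_apply, LinearMap.mulLeft_apply, map_mul, h]
  ring

theorem mulLeft_lie (g h : Uh) :
    ⁅(LinearMap.mulLeft ℂ g : Module.End ℂ Uh), (LinearMap.mulLeft ℂ h : Module.End ℂ Uh)⁆ = 0 := by
  refine LinearMap.ext fun f => ?_
  rw [LieRing.of_associative_ring_bracket, LinearMap.sub_apply, Module.End.mul_apply,
    Module.End.mul_apply]
  simp only [LinearMap.mulLeft_apply, LinearMap.zero_apply]
  ring

theorem smul_mulShift (c : ℂ) (g : Uh) (a : Fin 2 → ℂ) :
    c • mulShift g a = mulShift (MvPolynomial.C c * g) a := by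
  refine LinearMap.ext fun f => ?_
  rw [LinearMap.smul_apply, MvPolynomial.smul_eq_C_mul]
  simp only [mulShift_apply]
  ring

theorem mulShift_zero_left (a : Fin 2 → ℂ) : mulShift 0 a = 0 := by
  refine LinearMap.ext fun f => ?_
  simp [mulShift_apply]

theorem omegaOp_rel (p : Fin 2 → ℂ) (lam : Fin 2 → ℂˣ) (α b : ℂ) (x y : FreeLieAlgebra ℂ Gen)
    (h : Rel p x y) : FreeLieAlgebra.lift ℂ (omegaOp p lam α b) x =
      FreeLieAlgebra.lift ℂ (omegaOp p lam α b) y := by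
  cases h with
  | tt m n =>
    simp only [LieHom.map_lie, FreeLieAlgebra.lift_of_apply, map_zero, omegaOp, mulShift_lie,
      shift_C]
    rw [mul_comm, sub_self, mulShift_zero_left]
  | tE m n =>
    simp only [LieHom.map_lie, map_smul, FreeLieAlgebra.lift_of_apply, omegaOp,
      mulShift_lie, smul_mulShift, map_mul, shift_C, shift_linPoly, lamPow_add, toC_add]
    congr 1
    · simp only [linPoly, det2, map_sub, map_mul, map_add, map_neg, Pi.add_apply]
      ring
    · ring
  | EE m n =>
    simp only [LieHom.map_lie, map_smul, FreeLieAlgebra.lift_of_apply, omegaOp,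
      mulShift_lie, smul_mulShift, map_mul, shift_C, shift_linPoly, lamPow_add, toC_add]
    congr 1
    simp only [linPoly, det2, map_sub, map_mul, map_add, map_neg, Pi.add_apply, Pi.smul_apply,
      smul_eq_mul]
    ring
  | dE i m =>
    simp only [LieHom.map_lie, map_smul, FreeLieAlgebra.lift_of_apply, omegaOp,
      mulLeft_X_lie, toC]
  | dt i m =>
    simp only [LieHom.map_lie, map_smul, FreeLieAlgebra.lift_of_apply, omegaOp,
      mulLeft_X_lie, toC, Pi.add_apply]
  | dd i j =>
    simp only [LieHom.map_lie, FreeLieAlgebra.lift_of_apply, map_zero, omegaOp, mulLeft_lie]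
  | E_zero =>
    simp only [map_sub, map_smul, FreeLieAlgebra.lift_of_apply, omegaOp]
    refine LinearMap.ext fun f => ?_
    simp only [mulShift_apply, LinearMap.sub_apply, LinearMap.smul_apply, LinearMap.mulLeft_apply,
      toC_zero, shift_zero, lamPow_zero, linPoly, MvPolynomial.smul_eq_C_mul, zero_add,
      Pi.smul_apply, smul_eq_mul, map_mul, map_one]
    ring

theorem omegaZeroOp_rel (lam : Fin 2 → ℂˣ) (β : Fin 2 → ℂ) (b k : ℂ)
    (x y : FreeLieAlgebra ℂ Gen) (h : Rel 0 x y) :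
    FreeLieAlgebra.lift ℂ (omegaZeroOp lam β b k) x =
      FreeLieAlgebra.lift ℂ (omegaZeroOp lam β b k) y := by
  have ht : ∀ m, ∃ c : ℂ, omegaZeroOp lam β b k (Gen.t m) = mulShift (MvPolynomial.C c) (toC m) ∧
      (m ≠ 0 → c = lamPow lam m * k) := by
    intro m
    by_cases hm : m = 0
    · exact ⟨b, by simp [omegaZeroOp, hm, toC_zero], fun h => absurd hm h⟩
    · exact ⟨lamPow lam m * k, by simp [omegaZeroOp, hm], fun _ => rfl⟩
  cases h with
  | tt m n =>
    obtain ⟨c, hc, -⟩ := ht m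
    obtain ⟨c', hc', -⟩ := ht n
    simp only [LieHom.map_lie, FreeLieAlgebra.lift_of_apply, map_zero, hc, hc', mulShift_lie,
      shift_C]
    rw [mul_comm, sub_self, mulShift_zero_left]
  | tE m n =>
    obtain ⟨c, hc, h1⟩ := ht m
    obtain ⟨c', hc', h2⟩ := ht (m + n)
    have hE : omegaZeroOp lam β b k (Gen.E n) =
      mulShift (MvPolynomial.C (lamPow lam n) * linPoly (toC n) β) (toC n) := rfl
    have key : det2 (toC m) (toC n) * c' = det2 (toC m) (toC n) * (lamPow lam n * c) := by
      by_cases hm : m = 0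
      · simp [hm, det2, toC]
      by_cases hmn : m + n = 0
      · have : n = -m := by rw [eq_neg_iff_add_eq_zero, add_comm]; exact hmn
        have h0 : det2 (toC m) (toC n) = 0 := by
          subst this
          simp only [det2, toC, Pi.neg_apply, Int.cast_neg]
          ring
        simp [h0]
      · rw [h1 hm, h2 hmn, lamPow_add]
        ring
    simp only [LieHom.map_lie, map_smul, FreeLieAlgebra.lift_of_apply, hc, hc', hE,
      mulShift_lie, smul_mulShift, map_mul, shift_C, shift_linPoly, toC_add, add_zero]
    congr 1
    rw [← map_mul, neg_mul, key]
    simp only [linPoly, det2, map_sub, map_mul, map_neg]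
    ring
  | EE m n =>
    simp only [LieHom.map_lie, map_smul, FreeLieAlgebra.lift_of_apply, omegaZeroOp,
      mulShift_lie, smul_mulShift, map_mul, shift_C, shift_linPoly, lamPow_add, toC_add, add_zero]
    congr 1
    simp only [linPoly, det2, map_sub, map_mul, map_add, map_neg, Pi.add_apply]
    ring
  | dE i m =>
    simp only [LieHom.map_lie, map_smul, FreeLieAlgebra.lift_of_apply, omegaZeroOp,
      mulLeft_X_lie, toC]
  | dt i m =>
    obtain ⟨c, hc, -⟩ := ht m
    have hd : omegaZeroOp lam β b k (Gen.d i) = LinearMap.mulLeft ℂ (MvPolynomial.X i) := rfl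
    simp only [LieHom.map_lie, map_smul, FreeLieAlgebra.lift_of_apply, hc, hd,
      mulLeft_X_lie, toC, Pi.zero_apply, add_zero]
  | dd i j =>
    simp only [LieHom.map_lie, FreeLieAlgebra.lift_of_apply, map_zero, omegaZeroOp, mulLeft_lie]
  | E_zero =>
    simp only [FreeLieAlgebra.lift_of_apply, omegaZeroOp, Pi.zero_apply, zero_smul, sub_zero]
    refine LinearMap.ext fun f => ?_
    simp [mulShift_apply, toC_zero, linPoly]

/-- The representation of `L̃(p)` on `ℂ[∂₁, ∂₂]` defining `Ω(λ, α, b₀)`. -/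
def omegaRep (p : Fin 2 → ℂ) (lam : Fin 2 → ℂˣ) (α b : ℂ) : Ltilde p →ₗ⁅ℂ⁆ Module.End ℂ Uh :=
  liftL p (omegaOp p lam α b) (omegaOp_rel p lam α b)

/-- The representation of `L̃(0, 0)` on `ℂ[∂₁, ∂₂]` defining `Ω(λ, β, b₀, k)`. -/
def omegaZeroRep (lam : Fin 2 → ℂˣ) (β : Fin 2 → ℂ) (b k : ℂ) : Ltilde 0 →ₗ⁅ℂ⁆ Module.End ℂ Uh :=
  liftL 0 (omegaZeroOp lam β b k) (omegaZeroOp_rel lam β b k)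

/-- The `L̃(p)`-module `Ω(λ, α, b₀)`, with underlying space `ℂ[∂₁, ∂₂]`. -/
@[nolint unusedArguments]
def Omega (_p : Fin 2 → ℂ) (_lam : Fin 2 → ℂˣ) (_α _b : ℂ) : Type := Uh

/-- The `L̃(0, 0)`-module `Ω(λ, β, b₀, k)`, with underlying space `ℂ[∂₁, ∂₂]`. -/
@[nolint unusedArguments]
def OmegaZero (_lam : Fin 2 → ℂˣ) (_β : Fin 2 → ℂ) (_b _k : ℂ) : Type := Uh

instance (p : Fin 2 → ℂ) (lam : Fin 2 → ℂˣ) (α b : ℂ) : AddCommGroup (Omega p lam α b) :=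
  inferInstanceAs (AddCommGroup Uh)

instance (p : Fin 2 → ℂ) (lam : Fin 2 → ℂˣ) (α b : ℂ) : Module ℂ (Omega p lam α b) :=
  inferInstanceAs (Module ℂ Uh)

instance (lam : Fin 2 → ℂˣ) (β : Fin 2 → ℂ) (b k : ℂ) : AddCommGroup (OmegaZero lam β b k) :=
  inferInstanceAs (AddCommGroup Uh)

instance (lam : Fin 2 → ℂˣ) (β : Fin 2 → ℂ) (b k : ℂ) : Module ℂ (OmegaZero lam β b k) :=
  inferInstanceAs (Module ℂ Uh)

instance (p : Fin 2 → ℂ) (lam : Fin 2 → ℂˣ) (α b : ℂ) :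
    LieRingModule (Ltilde p) (Omega p lam α b) :=
  LieRingModule.compLieHom Uh (omegaRep p lam α b)

instance (p : Fin 2 → ℂ) (lam : Fin 2 → ℂˣ) (α b : ℂ) :
    LieModule ℂ (Ltilde p) (Omega p lam α b) :=
  LieModule.compLieHom Uh (omegaRep p lam α b)

instance (lam : Fin 2 → ℂˣ) (β : Fin 2 → ℂ) (b k : ℂ) :
    LieRingModule (Ltilde 0) (OmegaZero lam β b k) :=
  LieRingModule.compLieHom Uh (omegaZeroRep lam β b k)

instance (lam : Fin 2 → ℂˣ) (β : Fin 2 → ℂ) (b k : ℂ) :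
    LieModule ℂ (Ltilde 0) (OmegaZero lam β b k) :=
  LieModule.compLieHom Uh (omegaZeroRep lam β b k)

/-! The action on `Ω` in explicit form; an element of `Ω` is a polynomial `f`. -/

theorem Omega_t (p : Fin 2 → ℂ) (lam : Fin 2 → ℂˣ) (α b : ℂ) (m : Fin 2 → ℤ) (f : Uh) :
    (⁅tElt p m, (show Omega p lam α b from f)⁆ : Omega p lam α b) =
      (MvPolynomial.C (lamPow lam m * b) * shift (toC m + p) f : Uh) :=
  LinearMap.congr_fun (liftL_mk p _ (omegaOp_rel p lam α b) (Gen.t m)) f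

theorem Omega_E (p : Fin 2 → ℂ) (lam : Fin 2 → ℂˣ) (α b : ℂ) (m : Fin 2 → ℤ) (f : Uh) :
    (⁅EElt p m, (show Omega p lam α b from f)⁆ : Omega p lam α b) =
      (MvPolynomial.C (lamPow lam m) *
        (MvPolynomial.C (m 1 + p 1) * (MvPolynomial.X 0 + MvPolynomial.C (α * p 0)) -
          MvPolynomial.C (m 0 + p 0) * (MvPolynomial.X 1 + MvPolynomial.C (α * p 1))) *
        shift (toC m) f : Uh) :=
  LinearMap.congr_fun (liftL_mk p _ (omegaOp_rel p lam α b) (Gen.E m)) f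

theorem Omega_d (p : Fin 2 → ℂ) (lam : Fin 2 → ℂˣ) (α b : ℂ) (i : Fin 2) (f : Uh) :
    (⁅dElt p i, (show Omega p lam α b from f)⁆ : Omega p lam α b) =
      (MvPolynomial.X i * f : Uh) :=
  LinearMap.congr_fun (liftL_mk p _ (omegaOp_rel p lam α b) (Gen.d i)) f

theorem OmegaZero_t (lam : Fin 2 → ℂˣ) (β : Fin 2 → ℂ) (b k : ℂ) (m : Fin 2 → ℤ) (hm : m ≠ 0)
    (f : Uh) :
    (⁅tElt 0 m, (show OmegaZero lam β b k from f)⁆ : OmegaZero lam β b k) =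
      (MvPolynomial.C (lamPow lam m * k) * shift (toC m) f : Uh) := by
  have h := liftL_mk 0 _ (omegaZeroOp_rel lam β b k) (Gen.t m)
  rw [show omegaZeroOp lam β b k (Gen.t m) =
    mulShift (MvPolynomial.C (lamPow lam m * k)) (toC m) from if_neg hm] at h
  exact LinearMap.congr_fun h f

theorem OmegaZero_t_zero (lam : Fin 2 → ℂˣ) (β : Fin 2 → ℂ) (b k : ℂ) (f : Uh) :
    (⁅tElt 0 0, (show OmegaZero lam β b k from f)⁆ : OmegaZero lam β b k) =
      (MvPolynomial.C b * f : Uh) := by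
  have h := liftL_mk 0 _ (omegaZeroOp_rel lam β b k) (Gen.t 0)
  rw [show omegaZeroOp lam β b k (Gen.t 0) = mulShift (MvPolynomial.C b) 0 from by
    simp [omegaZeroOp]] at h
  refine (LinearMap.congr_fun h f).trans ?_
  rw [mulShift_apply, shift_zero]

theorem OmegaZero_E (lam : Fin 2 → ℂˣ) (β : Fin 2 → ℂ) (b k : ℂ) (m : Fin 2 → ℤ) (f : Uh) :
    (⁅EElt 0 m, (show OmegaZero lam β b k from f)⁆ : OmegaZero lam β b k) =
      (MvPolynomial.C (lamPow lam m) *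
        (MvPolynomial.C (m 1 : ℂ) * (MvPolynomial.X 0 + MvPolynomial.C (β 0)) -
          MvPolynomial.C (m 0 : ℂ) * (MvPolynomial.X 1 + MvPolynomial.C (β 1))) *
        shift (toC m) f : Uh) :=
  LinearMap.congr_fun (liftL_mk 0 _ (omegaZeroOp_rel lam β b k) (Gen.E m)) f

theorem OmegaZero_d (lam : Fin 2 → ℂˣ) (β : Fin 2 → ℂ) (b k : ℂ) (i : Fin 2) (f : Uh) :
    (⁅dElt 0 i, (show OmegaZero lam β b k from f)⁆ : OmegaZero lam β b k) =
      (MvPolynomial.X i * f : Uh) :=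
  LinearMap.congr_fun (liftL_mk 0 _ (omegaZeroOp_rel lam β b k) (Gen.d i)) f

end HeisVir

end

/-!
An operator on `ℂ[∂₁, ∂₂]` of weight `a` under `∂₁`, `∂₂` has the form `f ↦ g · f(∂ - a)`
(`apply_eq_mul_shift`). So a module that is free of rank one over `U(𝔥)` amounts to two families of
polynomials, `e_m` for `E(m)` and `c_m` for `t^m`, that satisfy the functional equations `OpRel`, and
these equations have to be solved. Throughout, `z` is the point at which the polynomials are
evaluated.

*Case `p ≠ 0`.* If `|n, p| ≠ 0`, then the `E(kn)` with `k ∈ ℤ` span a Witt algebra, with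
`E(0) = |z, p|`, which acts on the restrictions of polynomials to lines in the direction `n`. On such
a line `e_{-n}(z) e_n(z + n)` is a quadratic polynomial, as its difference in the direction `n` is
known; the degrees of the factors are one, because `(2, 0)` would force `e_{2n}` to have degree three.
This gives `e_n = a (|z, p| + P(|z, n|))` with a constant `a` and a polynomial `P`
(`OpRel.exists_witt`). To find `P`, let `E(n)` act on `e_m` for another vector `m`. Going from `m` to
`m + n` and back again multiplies the leading coefficient on a line in the direction `n` by a factor
that the relations prescribe, and this leaves two values for `P(y) - P(y - |m, n|)` in terms of the
degree (`wittString`). Finitely many values make this difference constant, so that `P` is affine, and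
a generic `m` yields the slope one (`OpRel.exists_affine`). Evaluating the relations at the points `0`
and `p` shows that the scalar factors are multiplicative in `n` and the constant terms proportional
to `|n, p|` (`OpRel.exists_good_form`). The same degree argument shows that `c_m` is constant for
`|m, p| ≠ 0`. For `m` parallel to `p`, the relations with the `E(n)` fix `e_m` and `c_m` on infinitely
many lines (`eq_zero_of_forall_line`).

*Case `p = 0`.* Now the `E(kn)` commute, the product `e_{-n}(z) e_n(z + n)` is constant on lines in
the direction `n`, and `e_n` is a polynomial in `|z, n|` (`OpRel.E_invariant`). Comparing leading
coefficients in the bracket of `E(m)` and `E(n)` shows that this polynomial is affine; the remaining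
scalars form a homomorphism from `ℤ²` to `ℂˣ × ℂ` (`OpRel.exists_form_zero`). Likewise `c_m` is affine
in `|z, m|` if `m ≠ 0`, and `[t^m, t^n] = 0` forces the slope to vanish.

The excluded cases, such as parallel vectors or vanishing structure constants, are avoided by choosing
auxiliary vectors off finitely many affine lines in `ℤ²` (`exists_forall_ne_zero`).
-/

noncomputable section

namespace HeisVir

attribute [local instance 100] LieRing.ofAssociativeRing

/-! ### Polynomials in one variable under translation -/

theorem eval_eq_of_periodic {P : Polynomial ℂ} {D : ℂ} (hD : D ≠ 0)
    (h : ∀ s, P.eval (s + D) = P.eval s) (s : ℂ) : P.eval s = P.eval 0 := by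
  have hk : ∀ k : ℕ, P.eval (k * D) = P.eval 0 := by
    intro k
    induction k with
    | zero => simp
    | succ k ih => rw [← ih, ← h (k * D)]; congr 1; push_cast; ring
  have : P = Polynomial.C (P.eval 0) := by
    refine Polynomial.eq_of_infinite_eval_eq _ _ (Set.Infinite.mono ?_
      (Set.infinite_range_of_injective (f := fun k : ℕ => (k : ℂ) * D) ?_))
    · rintro _ ⟨k, rfl⟩
      simp [hk]
    · intro a b hab
      exact_mod_cast mul_right_cancel₀ hD hab
  rw [this]; simp

theorem exists_affine_of_sub_const {P : Polynomial ℂ} {D c : ℂ} (hD : D ≠ 0)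
    (h : ∀ s, P.eval (s + D) - P.eval s = c) : ∀ s, P.eval s = c / D * s + P.eval 0 := by
  intro s
  have := eval_eq_of_periodic (P := P - Polynomial.C (c / D) * Polynomial.X) hD (fun s => by
    have := h s
    simp only [Polynomial.eval_sub, Polynomial.eval_mul, Polynomial.eval_C, Polynomial.eval_X]
    field_simp
    linear_combination D * this) s
  simp only [Polynomial.eval_sub, Polynomial.eval_mul, Polynomial.eval_C, Polynomial.eval_X] at this
  linear_combination this

/-- A polynomial that takes its values in a finite set outside the zeros of another polynomial is
constant. -/
theorem exists_eval_const_of_finite {R Z : Polynomial ℂ} (hZ : Z ≠ 0) (S : Finset ℂ)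
    (h : ∀ y, Z.eval y ≠ 0 → R.eval y ∈ S) : ∃ c, ∀ y, R.eval y = c := by
  have h0 : (∏ c ∈ S, (R - Polynomial.C c)) * Z = 0 := by
    refine Polynomial.funext fun y => ?_
    by_cases hy : Z.eval y = 0
    · simp [hy]
    · rw [Polynomial.eval_mul, Polynomial.eval_prod,
        Finset.prod_eq_zero (h y hy) (by simp)]
      simp
  rcases mul_eq_zero.1 h0 with h1 | h1
  · obtain ⟨c, -, hc⟩ := Finset.prod_eq_zero_iff.1 h1
    refine ⟨c, fun y => ?_⟩
    rw [sub_eq_zero.1 hc]; simp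
  · exact absurd h1 hZ

theorem taylor_coeff_top {f : Polynomial ℂ} {d : ℕ} (hd : f.natDegree ≤ d) (r : ℂ) :
    (Polynomial.taylor r f).coeff d = f.coeff d := by
  rcases hd.lt_or_eq with h | rfl
  · rw [Polynomial.coeff_eq_zero_of_natDegree_lt h,
      Polynomial.coeff_eq_zero_of_natDegree_lt (by rwa [Polynomial.natDegree_taylor])]
  · rw [Polynomial.coeff_taylor_natDegree]; rfl

theorem taylor_coeff_succ_top {f : Polynomial ℂ} {d : ℕ} (hd : f.natDegree ≤ d + 1) (r : ℂ) :
    (Polynomial.taylor r f).coeff d = f.coeff d + r * (d + 1) * f.coeff (d + 1) := by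
  have h2 : (Polynomial.hasseDeriv d f).natDegree < 2 := by
    have := Polynomial.natDegree_hasseDeriv_le f d
    omega
  rw [Polynomial.taylor_coeff, Polynomial.eval_eq_sum_range' h2]
  simp only [Finset.sum_range_succ, Finset.sum_range_zero, Polynomial.hasseDeriv_coeff]
  simp [add_comm 1 d]
  ring

/-- The operator `f ↦ (A + νs) f(s + r) - (B + νs) f(s)` does not raise the degree, and it acts
on leading coefficients as multiplication by an explicit scalar. -/
theorem shiftOp_coeff {f g : Polynomial ℂ} {d : ℕ} (hd : f.natDegree ≤ d) {ν r A B : ℂ}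
    (hg : ∀ s, (A + ν * s) * f.eval (s + r) - (B + ν * s) * f.eval s = g.eval s) :
    g.natDegree ≤ d ∧ g.coeff d = f.coeff d * (ν * r * d + A - B) := by
  have hgf : g = Polynomial.C A * Polynomial.taylor r f - Polynomial.C B * f +
      Polynomial.C ν * (Polynomial.X * (Polynomial.taylor r f - f)) := by
    refine Polynomial.funext fun s => ?_
    rw [← hg]
    simp only [Polynomial.eval_add, Polynomial.eval_sub, Polynomial.eval_mul, Polynomial.eval_C,
      Polynomial.eval_X, Polynomial.taylor_eval]
    ring
  constructor
  · rw [Polynomial.natDegree_le_iff_coeff_eq_zero]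
    intro N hN
    obtain ⟨N, rfl⟩ : ∃ k, N = k + 1 := ⟨N - 1, by omega⟩
    rw [hgf]
    simp only [Polynomial.coeff_add, Polynomial.coeff_sub, Polynomial.coeff_C_mul,
      Polynomial.coeff_X_mul, taylor_coeff_top (show f.natDegree ≤ N + 1 by omega),
      taylor_coeff_top (show f.natDegree ≤ N by omega),
      Polynomial.coeff_eq_zero_of_natDegree_lt (show f.natDegree < N + 1 by omega)]
    ring
  · rw [hgf]
    cases d with
    | zero =>
      simp only [Polynomial.coeff_add, Polynomial.coeff_sub,
        Polynomial.mul_coeff_zero, Polynomial.coeff_X_zero, taylor_coeff_top hd]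
      simp
      ring
    | succ d =>
      simp only [Polynomial.coeff_add, Polynomial.coeff_sub, Polynomial.coeff_C_mul,
        Polynomial.coeff_X_mul, taylor_coeff_top hd, taylor_coeff_succ_top hd]
      push_cast
      ring

/-- Degree bookkeeping for a step up and a step down along a string of a Witt algebra module: going
from `c` to `c'` and back multiplies the leading coefficient of `c` by a scalar that has to agree
with the structure constant, and this leaves two possible values of `α₀ - α₁ - dν`. -/
theorem wittString {c c' : Polynomial ℂ} (hc : c ≠ 0) {w ν μ g α₀ α₁ κ : ℂ} (hκ : κ ≠ 0)
    (hg : g + μ ≠ 0)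
    (h1 : ∀ s, (w + ν * s + α₀) * c.eval (s - 1) - (w + ν * s - μ + α₁) * c.eval s =
      (g + μ) * κ⁻¹ * c'.eval s)
    (h2 : ∀ s, (w + ν * s - α₀) * c'.eval (s + 1) - (w + ν * s - μ - ν - α₁) * c'.eval s =
      (μ + ν - g) * κ * c.eval s) :
    α₀ - α₁ = g + c.natDegree * ν ∨ α₀ - α₁ = ν - g + c.natDegree * ν := by
  have hgk : (g + μ) * κ⁻¹ ≠ 0 := mul_ne_zero hg (inv_ne_zero hκ)
  obtain ⟨d1, e1⟩ := shiftOp_coeff (f := c) (g := Polynomial.C ((g + μ) * κ⁻¹) * c')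
    (A := w + α₀) (B := w - μ + α₁) (ν := ν) (r := -1) le_rfl (fun s => by
      rw [Polynomial.eval_mul, Polynomial.eval_C, ← h1 s, ← sub_eq_add_neg]
      ring)
  rw [Polynomial.natDegree_C_mul hgk] at d1
  obtain ⟨-, e2⟩ := shiftOp_coeff (f := c') (g := Polynomial.C ((μ + ν - g) * κ) * c)
    (A := w - α₀) (B := w - μ - ν - α₁) (ν := ν) (r := 1) d1 (fun s => by
      rw [Polynomial.eval_mul, Polynomial.eval_C, ← h2 s]
      ring)
  rw [Polynomial.coeff_C_mul] at e1 e2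
  have hF : c.coeff c.natDegree ≠ 0 := by simpa using hc
  set F := c.coeff c.natDegree
  set F' := c'.coeff c.natDegree
  set d : ℂ := (c.natDegree : ℂ)
  have e3 : (g + μ) * F' = κ * (F * (ν * -1 * d + (w + α₀) - (w - μ + α₁))) := by
    rw [← e1]; field_simp
  have key : F * κ * ((α₀ - α₁ - g - d * ν) * (α₀ - α₁ - (ν - g) - d * ν)) = 0 := by
    linear_combination (g + μ) * e2 + (ν * d + w - α₀ - (w - μ - ν - α₁)) * e3
  rcases mul_eq_zero.1 ((mul_eq_zero.1 key).resolve_left (mul_ne_zero hF hκ)) with h | h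
  · left; linear_combination h
  · right; linear_combination h

/-! ### Polynomials in two variables: lines and integer points -/

theorem eval_shift (a z : Fin 2 → ℂ) (f : Uh) :
    MvPolynomial.eval z (shift a f) = MvPolynomial.eval (z - a) f := by
  have : (MvPolynomial.aeval z).comp (shift a) = MvPolynomial.aeval (R := ℂ) (z - a) := by
    ext i
    simp [shift]
  simpa [MvPolynomial.aeval_eq_eval] using DFunLike.congr_fun this f

theorem eq_zero_of_eval_int {f : Uh} (h : ∀ m, MvPolynomial.eval (toC m) f = 0) : f = 0 := by
  refine MvPolynomial.funext_set (fun _ => Set.range ((↑) : ℤ → ℂ))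
    (fun _ => Set.infinite_range_of_injective Int.cast_injective) fun x hx => ?_
  choose m hm using fun i => hx i (Set.mem_univ i)
  rw [show x = toC m from funext fun i => (hm i).symm, h, map_zero]

/-- A nonzero affine function on `ℤ²` with complex values. -/
def IsAff (φ : (Fin 2 → ℤ) → ℂ) : Prop :=
  ∃ a b c : ℂ, (a ≠ 0 ∨ b ≠ 0 ∨ c ≠ 0) ∧ ∀ m, φ m = a * m 0 + b * m 1 + c

/-- Finitely many affine lines do not cover `ℤ²`. -/
theorem exists_forall_ne_zero (l : List ((Fin 2 → ℤ) → ℂ)) (hl : ∀ φ ∈ l, IsAff φ) :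
    ∃ m, ∀ φ ∈ l, φ m ≠ 0 := by
  have : ∃ f : Uh, f ≠ 0 ∧ ∀ m, MvPolynomial.eval (toC m) f ≠ 0 → ∀ φ ∈ l, φ m ≠ 0 := by
    induction l with
    | nil => exact ⟨1, one_ne_zero, by simp⟩
    | cons φ l ih =>
      obtain ⟨f, hf, h⟩ := ih fun ψ hψ => hl ψ (List.mem_cons_of_mem _ hψ)
      obtain ⟨a, b, c, h0, hφ⟩ := hl φ List.mem_cons_self
      have hlin : (MvPolynomial.C a * MvPolynomial.X 0 + MvPolynomial.C b * MvPolynomial.X 1 +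
          MvPolynomial.C c : Uh) ≠ 0 := by
        intro h1
        have hz : ∀ z : Fin 2 → ℂ, a * z 0 + b * z 1 + c = 0 := fun z => by
          simpa using congrArg (MvPolynomial.eval z) h1
        have hc : c = 0 := by simpa using hz 0
        have ha : a = 0 := by simpa [hc] using hz ![1, 0]
        have hb : b = 0 := by simpa [hc] using hz ![0, 1]
        simp [ha, hb, hc] at h0
      refine ⟨_, mul_ne_zero hlin hf, fun m hm ψ hψ => ?_⟩
      rw [map_mul] at hm
      rcases List.mem_cons.1 hψ with rfl | hψ
      · rw [hφ]
        simpa [toC] using left_ne_zero_of_mul hm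
      · exact h m (right_ne_zero_of_mul hm) ψ hψ
  obtain ⟨f, hf, h⟩ := this
  by_contra! hcon
  refine hf (eq_zero_of_eval_int fun m => ?_)
  by_contra hm
  obtain ⟨φ, hφ, h0⟩ := hcon m
  exact h m hm φ hφ h0

/-- The restriction of a polynomial to the line `s ↦ z + s v`. -/
def line (z v : Fin 2 → ℂ) (f : Uh) : Polynomial ℂ :=
  MvPolynomial.aeval (fun i => Polynomial.C (z i) + Polynomial.C (v i) * Polynomial.X) f

theorem eval_line (z v : Fin 2 → ℂ) (f : Uh) (s : ℂ) :
    (line z v f).eval s = MvPolynomial.eval (z + s • v) f := by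
  have : (Polynomial.aeval s).comp (MvPolynomial.aeval
      (fun i => Polynomial.C (z i) + Polynomial.C (v i) * Polynomial.X)) =
      MvPolynomial.aeval (R := ℂ) (z + s • v) := by
    ext i
    simp [mul_comm s]
  simpa [MvPolynomial.aeval_eq_eval, line, Polynomial.coe_aeval_eq_eval] using
    DFunLike.congr_fun this f

theorem natDegree_line_le (z v : Fin 2 → ℂ) (f : Uh) :
    (line z v f).natDegree ≤ f.totalDegree := by
  have := MvPolynomial.aeval_natDegree_le f le_rfl
    (fun i => Polynomial.C (z i) + Polynomial.C (v i) * Polynomial.X) (n := 1) (fun i => by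
      rw [add_comm]; exact Polynomial.natDegree_linear_le)
  simpa [line] using this

/-! ### The polynomial relations -/

/-- The relations of `L̃(p)` for operators `E(m) f = e_m f(∂ - m)` and `t^m f = c_m f(∂ - m - p)` on
`ℂ[∂₁, ∂₂]`, written out as identities between the values of the polynomials `e_m` and `c_m`. -/
structure OpRel (p : Fin 2 → ℂ) (e c : (Fin 2 → ℤ) → Uh) : Prop where
  EE : ∀ m n z, MvPolynomial.eval (z - toC m) (e n) * MvPolynomial.eval z (e m) -
    MvPolynomial.eval (z - toC n) (e m) * MvPolynomial.eval z (e n) =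
      -det2 (toC m + p) (toC n + p) * MvPolynomial.eval z (e (m + n))
  tE : ∀ m n z, MvPolynomial.eval (z - (toC m + p)) (e n) * MvPolynomial.eval z (c m) -
    MvPolynomial.eval (z - toC n) (c m) * MvPolynomial.eval z (e n) =
      -det2 (toC m + p) (toC n + p) * MvPolynomial.eval z (c (m + n))
  tt : ∀ m n z, MvPolynomial.eval (z - (toC m + p)) (c n) * MvPolynomial.eval z (c m) =
    MvPolynomial.eval (z - (toC n + p)) (c m) * MvPolynomial.eval z (c n)
  zero : ∀ z, MvPolynomial.eval z (e 0) = det2 z p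

theorem toC_neg (m : Fin 2 → ℤ) : toC (-m) = -toC m := by
  ext i; simp [toC]

theorem det2_add_left (u v w : Fin 2 → ℂ) : det2 (u + v) w = det2 u w + det2 v w := by
  simp only [det2, Pi.add_apply]; ring

theorem det2_add_right (u v w : Fin 2 → ℂ) : det2 u (v + w) = det2 u v + det2 u w := by
  simp only [det2, Pi.add_apply]; ring

theorem det2_sub_left (u v w : Fin 2 → ℂ) : det2 (u - v) w = det2 u w - det2 v w := by
  simp only [det2, Pi.sub_apply]; ring

theorem det2_neg_left (u w : Fin 2 → ℂ) : det2 (-u) w = -det2 u w := by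
  simp only [det2, Pi.neg_apply]; ring

theorem det2_neg_right (u w : Fin 2 → ℂ) : det2 u (-w) = -det2 u w := by
  simp only [det2, Pi.neg_apply]; ring

theorem det2_smul_left (a : ℂ) (u w : Fin 2 → ℂ) : det2 (a • u) w = a * det2 u w := by
  simp only [det2, Pi.smul_apply, smul_eq_mul]; ring

theorem det2_smul_right (a : ℂ) (u w : Fin 2 → ℂ) : det2 u (a • w) = a * det2 u w := by
  simp only [det2, Pi.smul_apply, smul_eq_mul]; ring

theorem det2_self (u : Fin 2 → ℂ) : det2 u u = 0 := by
  simp only [det2]; ring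

theorem det2_swap (u v : Fin 2 → ℂ) : det2 v u = -det2 u v := by
  simp only [det2]; ring

/-- Cramer's rule. -/
theorem eq_add_smul_of_det2_ne_zero {u v : Fin 2 → ℂ} (h : det2 u v ≠ 0) (z : Fin 2 → ℂ) :
    z = (-(det2 z u / det2 u v)) • v + (det2 z v / det2 u v) • u := by
  ext i
  simp only [Pi.add_apply, Pi.smul_apply, smul_eq_mul]
  field_simp
  fin_cases i <;> simp [det2] <;> ring

/-! ### Case `p ≠ 0`: the Witt algebras `⨁ₖ ℂ E(kn)` -/

section nonzero

variable {p : Fin 2 → ℂ} {e c : (Fin 2 → ℤ) → Uh}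

/-- The relation `[E(n), E(-n)] = -2 |n, p| E(0)` prescribes the difference of
`e_{-n}(z) e_n(z + n)` in the direction `n`, and with it this product up to a constant on each line. -/
theorem OpRel.line_mul_line (H : OpRel p e c) {n : Fin 2 → ℤ} (hn : det2 (toC n) p ≠ 0)
    (z : Fin 2 → ℂ) :
    (line z (toC n) (e n)).natDegree + (line z (toC n) (e (-n))).natDegree = 2 ∧
    ∃ k, ∀ s, (line z (toC n) (e (-n))).eval s * (line z (toC n) (e n)).eval (s + 1) =
      (det2 z p + det2 (toC n) p * s) * (det2 z p + det2 (toC n) p * (s + 1)) + k := by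
  set ν := det2 (toC n) p with hν
  set w := det2 z p
  set E := line z (toC n) (e n)
  set E' := line z (toC n) (e (-n))
  set G := E' * Polynomial.taylor 1 E with hG
  set Q : Polynomial ℂ := Polynomial.C (ν ^ 2) * Polynomial.X ^ 2 +
    Polynomial.C (2 * w * ν + ν ^ 2) * Polynomial.X + Polynomial.C (w * (w + ν)) with hQ
  have hdiff : ∀ s, G.eval (s + 1) - G.eval s = 2 * ν * (w + ν * (s + 1)) := by
    intro s
    have := H.EE n (-n) (z + (s + 1) • toC n)
    rw [add_neg_cancel, H.zero, toC_neg,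
      show z + (s + 1) • toC n - toC n = z + s • toC n by module,
      show z + (s + 1) • toC n - -toC n = z + (s + 1 + 1) • toC n by module] at this
    simp only [det2_add_left, det2_add_right, det2_neg_right, det2_self,
      det2_smul_left, ← hν, det2_swap (toC n) p, ← eval_line] at this
    simp only [hG, Polynomial.eval_mul, Polynomial.taylor_eval]
    linear_combination -this
  obtain ⟨k, hk⟩ : ∃ k, ∀ s, G.eval s = Q.eval s + k := by
    refine ⟨(G - Q).eval 0, fun s => ?_⟩
    rw [← eval_eq_of_periodic (P := G - Q) one_ne_zero (fun s => ?_) s]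
    · simp
    · simp only [Polynomial.eval_sub]
      have : Q.eval (s + 1) - Q.eval s = 2 * ν * (w + ν * (s + 1)) := by
        simp [hQ]; ring
      linear_combination hdiff s - this
  refine ⟨?_, k, fun s => ?_⟩
  · have hGQ : G = Polynomial.C (ν ^ 2) * Polynomial.X ^ 2 +
        Polynomial.C (2 * w * ν + ν ^ 2) * Polynomial.X + Polynomial.C (w * (w + ν) + k) := by
      refine Polynomial.funext fun s => ?_
      rw [hk]; simp [hQ]; ring
    have hdeg : G.natDegree = 2 := by
      rw [hGQ]; exact Polynomial.natDegree_quadratic (pow_ne_zero 2 hn)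
    have h0 : G ≠ 0 := by
      rintro h; rw [h] at hdeg; simp at hdeg
    rw [hG, Polynomial.natDegree_mul (left_ne_zero_of_mul h0) (right_ne_zero_of_mul h0),
      Polynomial.natDegree_taylor] at hdeg
    omega
  · have := hk s
    simp only [hG, Polynomial.eval_mul, Polynomial.taylor_eval] at this
    rw [this]; simp [hQ]; ring

/-- If `e_n` had degree two on a line, then `e_{-n}` would be constant there, and `e_{2n}` would have
degree three; but the degrees of `e_{2n}` and `e_{-2n}` also add up to two. -/
theorem OpRel.natDegree_line_ne_two (H : OpRel p e c) {n : Fin 2 → ℤ} (hn : det2 (toC n) p ≠ 0)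
    (z : Fin 2 → ℂ) : (line z (toC n) (e n)).natDegree ≠ 2 := by
  intro h2
  obtain ⟨h, k, -⟩ := H.line_mul_line hn z
  have h2n : toC (n + n) = (2 : ℂ) • toC n := by rw [toC_add]; module
  have hdeg2 : (line z (toC n) (e (n + n))).natDegree ≤ 2 := by
    obtain ⟨h', -⟩ := H.line_mul_line (n := n + n) (by
      rw [h2n, det2_smul_left]; exact mul_ne_zero two_ne_zero hn) z
    have : line z (toC (n + n)) (e (n + n)) =
        (line z (toC n) (e (n + n))).comp (Polynomial.C 2 * Polynomial.X) := by
      refine Polynomial.funext fun s => ?_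
      rw [Polynomial.eval_comp, eval_line, eval_line, h2n]
      congr 2
      simp only [Polynomial.eval_mul, Polynomial.eval_C, Polynomial.eval_X]
      module
    rw [this, Polynomial.natDegree_comp, Polynomial.natDegree_C_mul_X 2 two_ne_zero] at h'
    omega
  obtain ⟨a, ha⟩ := Polynomial.natDegree_eq_zero.1
    (show (line z (toC n) (e (-n))).natDegree = 0 by omega)
  -- the bracket of `E(2n)` and `E(-n)` expresses `e_n` as a difference of translates of `e_{2n}`
  have hE : ∀ s, (a + 0 * s) * (line z (toC n) (e (n + n))).eval (s + 1) -
      (a + 0 * s) * (line z (toC n) (e (n + n))).eval s =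
      (Polynomial.C (3 * det2 (toC n) p) * line z (toC n) (e n)).eval s := by
    intro s
    have := H.EE (n + n) (-n) (z + s • toC n)
    rw [add_neg_cancel_right, toC_neg, h2n,
      show z + s • toC n - (2 : ℂ) • toC n = z + (s - 2) • toC n by module,
      show z + s • toC n - -toC n = z + (s + 1) • toC n by module] at this
    simp only [det2_add_left, det2_add_right, det2_neg_right, det2_self,
      det2_smul_left, det2_swap (toC n) p, ← eval_line, ← ha, Polynomial.eval_C] at this
    simp only [Polynomial.eval_mul, Polynomial.eval_C]
    linear_combination -this
  have := (shiftOp_coeff hdeg2 hE).2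
  rw [Polynomial.coeff_C_mul] at this
  have hl : (line z (toC n) (e n)).coeff 2 ≠ 0 := by
    rw [← h2, Polynomial.coeff_natDegree, Ne, Polynomial.leadingCoeff_eq_zero]
    rintro h; rw [h] at h2; simp at h2
  refine mul_ne_zero (mul_ne_zero three_ne_zero hn) hl ?_
  rw [this]; ring

/-- Along lines in the direction `n`, the polynomials `e_n` and `e_{-n}` are affine, with mutually
inverse slopes and opposite constant terms. -/
theorem OpRel.line_affine (H : OpRel p e c) {n : Fin 2 → ℤ} (hn : det2 (toC n) p ≠ 0)
    (z : Fin 2 → ℂ) : ∃ x y x' y', (∀ s, (line z (toC n) (e n)).eval s = x * s + y) ∧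
      (∀ s, (line z (toC n) (e (-n))).eval s = x' * s + y') ∧ x * x' = det2 (toC n) p ^ 2 ∧
      x' * y + y' * x = 2 * det2 (toC n) p * det2 z p := by
  obtain ⟨h, k, hk⟩ := H.line_mul_line hn z
  have h1 := H.natDegree_line_ne_two hn z
  have h2 : (line z (toC n) (e (-n))).natDegree ≠ 2 := by
    have hn' : det2 (toC (-n)) p ≠ 0 := by rwa [toC_neg, det2_neg_left, neg_ne_zero]
    have := H.natDegree_line_ne_two hn' z
    have hl : line z (toC (-n)) (e (-n)) =
        (line z (toC n) (e (-n))).comp (Polynomial.C (-1) * Polynomial.X) := by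
      refine Polynomial.funext fun s => ?_
      rw [Polynomial.eval_comp, eval_line, eval_line, toC_neg]
      congr 2
      simp only [Polynomial.eval_mul, Polynomial.eval_C, Polynomial.eval_X]
      module
    rwa [hl, Polynomial.natDegree_comp,
      Polynomial.natDegree_C_mul_X (-1) (neg_ne_zero.2 one_ne_zero), mul_one] at this
  have e1 := Polynomial.eq_X_add_C_of_natDegree_le_one
    (show (line z (toC n) (e n)).natDegree ≤ 1 by omega)
  have e2 := Polynomial.eq_X_add_C_of_natDegree_le_one
    (show (line z (toC n) (e (-n))).natDegree ≤ 1 by omega)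
  set x := (line z (toC n) (e n)).coeff 1
  set y := (line z (toC n) (e n)).coeff 0
  set x' := (line z (toC n) (e (-n))).coeff 1
  set y' := (line z (toC n) (e (-n))).coeff 0
  have f1 : ∀ s, (line z (toC n) (e n)).eval s = x * s + y := fun s => by rw [e1]; simp
  have f2 : ∀ s, (line z (toC n) (e (-n))).eval s = x' * s + y' := fun s => by rw [e2]; simp
  refine ⟨x, y, x', y', f1, f2, ?_, ?_⟩
  · have a0 := hk 0
    have a1 := hk 1
    have a2 := hk (-1)
    rw [f1, f2] at a0 a1 a2
    linear_combination a1 / 2 + a2 / 2 - a0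
  · have a0 := hk 0
    have a2 := hk (-1)
    rw [f1, f2] at a0 a2
    linear_combination a0 - a2

/-- The two operators `E(±n)` with `|n, p| ≠ 0` form part of a module over a Witt algebra that is
free of rank one over polynomials in `w = |z, p|`, where the coordinate `|z, n|` is a parameter. -/
theorem OpRel.exists_witt (H : OpRel p e c) {n : Fin 2 → ℤ} (hn : det2 (toC n) p ≠ 0) :
    ∃ a : ℂ, a ≠ 0 ∧ ∃ P : Polynomial ℂ, ∀ z,
      MvPolynomial.eval z (e n) = a * (det2 z p + P.eval (det2 z (toC n))) ∧
      MvPolynomial.eval z (e (-n)) = a⁻¹ * (det2 z p - P.eval (det2 z (toC n))) := by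
  set ν := det2 (toC n) p with hν
  -- the slopes of `e_n` and `e_{-n}` are polynomials whose product is a nonzero constant
  set f := shift (-toC n) (e n) - e n with hf
  set f' := shift (-toC n) (e (-n)) - e (-n) with hf'
  have hslope : ∀ z x y (g : Uh), (∀ s, (line z (toC n) g).eval s = x * s + y) →
      MvPolynomial.eval z (shift (-toC n) g - g) = x ∧ MvPolynomial.eval z g = y := by
    intro z x y g h
    have h0 := h 0
    have h1 := h 1
    rw [eval_line] at h0 h1
    rw [zero_smul, add_zero] at h0
    rw [one_smul] at h1
    rw [map_sub, eval_shift, sub_neg_eq_add, h0, h1]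
    constructor <;> ring
  have hff : f * f' = MvPolynomial.C (ν ^ 2) := by
    refine MvPolynomial.funext fun z => ?_
    obtain ⟨x, y, x', y', h1, h2, h3, -⟩ := H.line_affine hn z
    rw [map_mul, hf, hf', (hslope z x y _ h1).1, (hslope z x' y' _ h2).1, h3, MvPolynomial.eval_C]
  have hu : IsUnit f := by
    refine isUnit_of_mul_isUnit_left (y := f') ?_
    rw [hff]
    exact (IsUnit.mk0 _ (pow_ne_zero 2 hn)).map MvPolynomial.C
  obtain ⟨b, hb, hfb⟩ := MvPolynomial.isUnit_iff_eq_C_of_isReduced.1 hu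
  have hb0 : b ≠ 0 := hb.ne_zero
  -- the values at the points where `|z, p| = 0` determine `P`
  refine ⟨b / ν, div_ne_zero hb0 hn,
    Polynomial.C (ν / b) * line 0 (-(1 / ν) • p) (e n), fun z => ?_⟩
  set u := det2 z (toC n)
  have hz : z = u • (-(1 / ν) • p) + (det2 z p / ν) • toC n := by
    have := eq_add_smul_of_det2_ne_zero hn z
    rw [← hν] at this
    rw [smul_smul, show u * -(1 / ν) = -(u / ν) by ring]
    exact this
  obtain ⟨x, y, x', y', h1, h2, h3, h4⟩ := H.line_affine hn (u • (-(1 / ν) • p))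
  have hx : x = b := by
    rw [← (hslope _ x y _ h1).1, ← hf, hfb, MvPolynomial.eval_C]
  have hq : det2 (u • (-(1 / ν) • p)) p = 0 := by
    rw [det2_smul_left, det2_smul_left, det2_self]; ring
  rw [hq, mul_zero] at h4
  have hy := (hslope _ x y _ h1).2
  have e1 := h1 (det2 z p / ν)
  have e2 := h2 (det2 z p / ν)
  rw [eval_line, ← hz] at e1 e2
  rw [Polynomial.eval_mul, Polynomial.eval_C, eval_line, zero_add, hy, e1, e2]
  subst hx
  have hx' : x' = ν ^ 2 / x := by rw [eq_div_iff hb0]; linear_combination h3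
  have hy' : y' = -(ν ^ 2 * y / x ^ 2) := by
    have : y' = -(x' * y) / x := by rw [eq_div_iff hb0]; linear_combination h4
    rw [this, hx']; field_simp
  rw [hx', hy']
  constructor
  · field_simp
  · field_simp
    ring

/-! ### Case `p ≠ 0`: the polynomials `e_m` with `|m, p| ≠ 0` are affine -/

theorem isAff_of_eq {φ : (Fin 2 → ℤ) → ℂ} (v : Fin 2 → ℂ) (x : ℂ) (h : v ≠ 0 ∨ x ≠ 0)
    (hφ : ∀ m, φ m = det2 (toC m) v + x) : IsAff φ := by
  refine ⟨v 1, -v 0, x, ?_, fun m => by rw [hφ]; simp only [det2, toC]; ring⟩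
  by_contra! h0
  refine h.elim (fun h => h ?_) (fun h => h h0.2.2)
  ext i; fin_cases i
  · simpa using h0.2.1
  · simpa using h0.1

theorem ne_zero_of_det2_left {u v : Fin 2 → ℂ} (h : det2 u v ≠ 0) : u ≠ 0 := by
  rintro rfl; simp [det2] at h

theorem ne_zero_of_det2_right {u v : Fin 2 → ℂ} (h : det2 u v ≠ 0) : v ≠ 0 := by
  rintro rfl; simp [det2] at h

theorem add_ne_zero_of_det2 {u v : Fin 2 → ℂ} (h : det2 u v ≠ 0) : u + v ≠ 0 := by
  intro h0
  rw [add_eq_zero_iff_eq_neg.1 h0, det2_neg_left, det2_self, neg_zero] at h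
  exact h rfl

/-- Degree bookkeeping along the string `x ↦ E(n) x` and back, where the polynomials `x` and `y`
stand for `e_m` and `e_{m+n}`, or for `c_m` and `c_{m+n}`. -/
theorem string_dichotomy {n m : Fin 2 → ℤ} {a : ℂ} (ha : a ≠ 0)
    {P : Polynomial ℂ}
    (hP : ∀ z, MvPolynomial.eval z (e n) = a * (det2 z p + P.eval (det2 z (toC n))) ∧
      MvPolynomial.eval z (e (-n)) = a⁻¹ * (det2 z p - P.eval (det2 z (toC n))))
    {x y : Uh} {q : Fin 2 → ℂ} (hq : det2 q p = det2 (toC m) p)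
    (h1 : ∀ z, MvPolynomial.eval (z - q) (e n) * MvPolynomial.eval z x -
      MvPolynomial.eval (z - toC n) x * MvPolynomial.eval z (e n) =
        -det2 (toC m + p) (toC n + p) * MvPolynomial.eval z y)
    (h2 : ∀ z, MvPolynomial.eval (z - (q + toC n)) (e (-n)) * MvPolynomial.eval z y -
      MvPolynomial.eval (z - toC (-n)) y * MvPolynomial.eval z (e (-n)) =
        -det2 (toC (m + n) + p) (toC (-n) + p) * MvPolynomial.eval z x)
    (hmn : det2 (toC m + p) (toC n + p) ≠ 0) (z : Fin 2 → ℂ) (hx : line z (toC n) x ≠ 0) :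
    P.eval (det2 z (toC n)) - P.eval (det2 z (toC n) - det2 q (toC n)) =
      det2 (toC m) (toC n) - det2 (toC n) p +
        (line z (toC n) x).natDegree * det2 (toC n) p ∨
    P.eval (det2 z (toC n)) - P.eval (det2 z (toC n) - det2 q (toC n)) =
      det2 (toC n) p - (det2 (toC m) (toC n) - det2 (toC n) p) +
        (line z (toC n) x).natDegree * det2 (toC n) p := by
  have hK : det2 (toC m + p) (toC n + p) =
      det2 (toC m) (toC n) - det2 (toC n) p + det2 (toC m) p := by
    simp only [det2_add_left, det2_add_right, det2_self, det2_swap (toC n) p]; ring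
  have hK' : det2 (toC (m + n) + p) (toC (-n) + p) =
      det2 (toC m) p + det2 (toC n) p - (det2 (toC m) (toC n) - det2 (toC n) p) := by
    simp only [toC_add, toC_neg, det2_add_left, det2_add_right, det2_self, det2_neg_right,
      det2_swap (toC n) p]
    ring
  refine wittString (c := line z (toC n) x) (c' := line z (toC n) y) hx ha
    (w := det2 z p) (μ := det2 (toC m) p) (hK ▸ hmn) (fun s => ?_) (fun s => ?_)
  · have := h1 (z + s • toC n)
    rw [hK, (hP _).1, (hP _).1, show z + s • toC n - toC n = z + (s - 1) • toC n by module,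
      ← eval_line, ← eval_line, ← eval_line] at this
    simp only [det2_sub_left, det2_add_left, det2_smul_left, det2_self, hq, mul_zero,
      add_zero] at this
    field_simp
    linear_combination -this
  · have := h2 (z + s • toC n)
    rw [hK', (hP _).2, (hP _).2, toC_neg,
      show z + s • toC n - -toC n = z + (s + 1) • toC n by module,
      ← eval_line, ← eval_line, ← eval_line] at this
    simp only [det2_sub_left, det2_add_left, det2_smul_left, det2_self, hq, mul_zero,
      add_zero] at this
    have h3 := congrArg (a * ·) this
    field_simp at h3
    linear_combination -h3

theorem OpRel.string_E (H : OpRel p e c) {n m : Fin 2 → ℤ} {a : ℂ} (ha : a ≠ 0)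
    {P : Polynomial ℂ}
    (hP : ∀ z, MvPolynomial.eval z (e n) = a * (det2 z p + P.eval (det2 z (toC n))) ∧
      MvPolynomial.eval z (e (-n)) = a⁻¹ * (det2 z p - P.eval (det2 z (toC n))))
    (hmn : det2 (toC m + p) (toC n + p) ≠ 0) (z : Fin 2 → ℂ) (hx : line z (toC n) (e m) ≠ 0) :
    P.eval (det2 z (toC n)) - P.eval (det2 z (toC n) - det2 (toC m) (toC n)) =
      det2 (toC m) (toC n) - det2 (toC n) p +
        (line z (toC n) (e m)).natDegree * det2 (toC n) p ∨
    P.eval (det2 z (toC n)) - P.eval (det2 z (toC n) - det2 (toC m) (toC n)) =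
      det2 (toC n) p - (det2 (toC m) (toC n) - det2 (toC n) p) +
        (line z (toC n) (e m)).natDegree * det2 (toC n) p := by
  refine string_dichotomy ha hP (y := e (m + n)) rfl (H.EE m n) (fun z => ?_) hmn z hx
  have := H.EE (m + n) (-n) z
  rw [add_neg_cancel_right] at this
  rwa [← toC_add]

theorem OpRel.exists_eval_E_ne_zero (H : OpRel p e c) {m : Fin 2 → ℤ} (hm : det2 (toC m) p ≠ 0) :
    ∃ z, MvPolynomial.eval z (e m) ≠ 0 := by
  obtain ⟨a, ha, P, hP⟩ := H.exists_witt hm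
  by_contra! h
  have h0 := h 0
  have h1 := h (toC m)
  rw [(hP _).1] at h0 h1
  rw [det2_self] at h1
  have h00 : ∀ v, det2 0 v = 0 := fun v => by simp [det2]
  rw [h00, h00] at h0
  refine mul_ne_zero ha hm ?_
  linear_combination h1 - h0

/-- The polynomial `P` that the Witt algebra leaves undetermined is affine: by the two possible values
of `P(y) - P(y - |m, n|)` for each of the finitely many degrees of `e_m` on lines, this difference is
constant. -/
theorem OpRel.witt_affine (H : OpRel p e c) {n : Fin 2 → ℤ} (hn : det2 (toC n) p ≠ 0)
    {a : ℂ} (ha : a ≠ 0) {P : Polynomial ℂ}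
    (hP : ∀ z, MvPolynomial.eval z (e n) = a * (det2 z p + P.eval (det2 z (toC n))) ∧
      MvPolynomial.eval z (e (-n)) = a⁻¹ * (det2 z p - P.eval (det2 z (toC n)))) :
    ∃ A, ∀ y, P.eval y = A * y + P.eval 0 := by
  obtain ⟨m, hm⟩ := exists_forall_ne_zero
    [fun m => det2 (toC m) p, fun m => det2 (toC m) (toC n),
      fun m => det2 (toC m + p) (toC n + p)] (by
    simp only [List.forall_mem_cons, List.not_mem_nil, false_imp_iff, implies_true, and_true]
    exact ⟨isAff_of_eq p 0 (.inl (ne_zero_of_det2_right hn)) (by simp),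
      isAff_of_eq (toC n) 0 (.inl (ne_zero_of_det2_left hn)) (by simp),
      isAff_of_eq (toC n + p) (det2 p (toC n + p)) (.inl (add_ne_zero_of_det2 hn))
        fun m => det2_add_left _ _ _⟩)
  simp only [List.forall_mem_cons, List.not_mem_nil, false_imp_iff, implies_true, and_true] at hm
  obtain ⟨hm1, hm2, hm3⟩ := hm
  set ν := det2 (toC n) p with hν
  set D := det2 (toC m) (toC n) with hD
  obtain ⟨z, hz⟩ := H.exists_eval_E_ne_zero hm1
  -- the lines in the direction `n` are parametrized by the points `y • q`
  set q := -(1 / ν) • p with hq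
  have hqn : ∀ y : ℂ, det2 (y • q) (toC n) = y := by
    intro y
    rw [hq, det2_smul_left, det2_smul_left, det2_swap (toC n) p, ← hν]
    field_simp
  have hzq : z = (det2 z p / ν) • toC n + det2 z (toC n) • q := by
    have := eq_add_smul_of_det2_ne_zero hn z
    rw [← hν] at this
    rw [hq, smul_smul, show det2 z (toC n) * -(1 / ν) = -(det2 z (toC n) / ν) by ring, add_comm]
    exact this
  obtain ⟨k, hk⟩ := exists_eval_const_of_finite
    (R := P - Polynomial.taylor (-D) P) (Z := line ((det2 z p / ν) • toC n) q (e m))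
    (by
      intro h
      have := eval_line ((det2 z p / ν) • toC n) q (e m) (det2 z (toC n))
      rw [h, ← hzq, Polynomial.eval_zero] at this
      exact hz this.symm)
    ((Finset.range ((e m).totalDegree + 1)).image (fun d : ℕ => D - ν + d * ν) ∪
      (Finset.range ((e m).totalDegree + 1)).image (fun d : ℕ => ν - (D - ν) + d * ν))
    (fun y hy => by
      have hl : line (y • q) (toC n) (e m) ≠ 0 := by
        intro h
        have := eval_line (y • q) (toC n) (e m) (det2 z p / ν)
        rw [h, Polynomial.eval_zero, add_comm, ← eval_line] at this
        exact hy this.symm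
      have hd := Finset.mem_range.2 (Nat.lt_succ_of_le (natDegree_line_le (y • q) (toC n) (e m)))
      have := H.string_E ha hP hm3 (y • q) hl
      rw [hqn] at this
      rw [Polynomial.eval_sub, Polynomial.taylor_eval, ← sub_eq_add_neg]
      exact Finset.mem_union.2 (this.imp
        (fun h => Finset.mem_image.2 ⟨_, hd, h.symm⟩)
        (fun h => Finset.mem_image.2 ⟨_, hd, h.symm⟩)))
  refine ⟨k / D, exists_affine_of_sub_const hm2 fun s => ?_⟩
  have := hk (s + D)
  rw [Polynomial.eval_sub, Polynomial.taylor_eval, add_neg_cancel_right] at this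
  exact this

/-- For `|n, p| ≠ 0`, the polynomial `e_n` is a multiple of `|z, n + p|` plus a constant. The
slope of the affine polynomial that the Witt algebra leaves undetermined is fixed by comparing with
a generic `e_m`, whose degree along lines in the direction `n` is at most one. -/
theorem OpRel.exists_affine (H : OpRel p e c) {n : Fin 2 → ℤ} (hn : det2 (toC n) p ≠ 0) :
    ∃ (a : ℂˣ) (b : ℂ), ∀ z, MvPolynomial.eval z (e n) = a * (det2 z (toC n + p) + b) ∧
      MvPolynomial.eval z (e (-n)) = (a : ℂ)⁻¹ * (det2 z (-toC n + p) - b) := by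
  obtain ⟨a, ha, P, hP⟩ := H.exists_witt hn
  obtain ⟨A, hA⟩ := H.witt_affine hn ha hP
  set ν := det2 (toC n) p with hν
  suffices hA1 : A = 1 by
    refine ⟨Units.mk0 a ha, P.eval 0, fun z => ?_⟩
    rw [(hP z).1, (hP z).2, hA, hA1, det2_add_right, det2_add_right, det2_neg_right,
      Units.val_mk0]
    constructor <;> ring
  obtain ⟨m, hm⟩ := exists_forall_ne_zero
    [fun m => det2 (toC m) p, fun m => det2 (toC m) (toC n),
      fun m => det2 (toC m + p) (toC n + p), fun m => (A - 1) * det2 (toC m) (toC n) + ν,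
      fun m => (A + 1) * det2 (toC m) (toC n) - 2 * ν,
      fun m => (A + 1) * det2 (toC m) (toC n) - 3 * ν] (by
    simp only [List.forall_mem_cons, List.not_mem_nil, false_imp_iff, implies_true, and_true]
    refine ⟨isAff_of_eq p 0 (.inl (ne_zero_of_det2_right hn)) (by simp),
      isAff_of_eq (toC n) 0 (.inl (ne_zero_of_det2_left hn)) (by simp),
      isAff_of_eq (toC n + p) (det2 p (toC n + p)) (.inl (add_ne_zero_of_det2 hn))
        fun m => det2_add_left _ _ _,
      isAff_of_eq ((A - 1) • toC n) ν (.inr hn) fun m => by rw [det2_smul_right],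
      isAff_of_eq ((A + 1) • toC n) (-(2 * ν)) (.inr ?_) fun m => by
        rw [det2_smul_right, sub_eq_add_neg],
      isAff_of_eq ((A + 1) • toC n) (-(3 * ν)) (.inr ?_) fun m => by
        rw [det2_smul_right, sub_eq_add_neg]⟩
    · exact neg_ne_zero.2 (mul_ne_zero two_ne_zero hn)
    · exact neg_ne_zero.2 (mul_ne_zero three_ne_zero hn))
  simp only [List.forall_mem_cons, List.not_mem_nil, false_imp_iff, implies_true, and_true] at hm
  obtain ⟨hm1, hm2, hm3, hm4, hm5, hm6⟩ := hm
  obtain ⟨z, hz⟩ := H.exists_eval_E_ne_zero hm1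
  have hl : line z (toC n) (e m) ≠ 0 := by
    intro h
    have := eval_line z (toC n) (e m) 0
    rw [h, zero_smul, add_zero, Polynomial.eval_zero] at this
    exact hz this.symm
  have hd : (line z (toC n) (e m)).natDegree ≤ 1 := by
    obtain ⟨a', ha', P', hP'⟩ := H.exists_witt hm1
    obtain ⟨A', hA'⟩ := H.witt_affine hm1 ha' hP'
    have : line z (toC n) (e m) =
        Polynomial.C (a' * (ν + A' * det2 (toC n) (toC m))) * Polynomial.X +
          Polynomial.C (a' * (det2 z p + A' * det2 z (toC m) + P'.eval 0)) := by
      refine Polynomial.funext fun s => ?_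
      rw [eval_line, (hP' _).1, hA']
      simp only [det2_add_left, det2_smul_left, Polynomial.eval_add, Polynomial.eval_mul,
        Polynomial.eval_C, Polynomial.eval_X, ← hν]
      ring
    rw [this]
    exact Polynomial.natDegree_linear_le
  have key := H.string_E ha hP hm3 z hl
  rw [hA, hA (det2 z (toC n) - _), ← hν] at key
  rcases Nat.le_one_iff_eq_zero_or_eq_one.1 hd with h | h <;> rw [h] at key <;> push_cast at key
  · rcases key with k | k
    · exact absurd (by linear_combination k) hm4
    · exact absurd (by linear_combination k) hm5
  · rcases key with k | k
    · exact mul_right_cancel₀ hm2 (by linear_combination k)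
    · exact absurd (by linear_combination k) hm6

/-! ### Characters of `ℤ²` from partially multiplicative functions -/

theorem map_zsmul_of_partial {G : Type*} [CommGroup G] {Good : (Fin 2 → ℤ) → Prop}
    {f : (Fin 2 → ℤ) → G}
    (hmul : ∀ m n, Good m → Good n → Good (m + n) → f (m + n) = f m * f n)
    (hneg : ∀ m, Good m → f (-m) = (f m)⁻¹) {g : Fin 2 → ℤ} (hg : ∀ i : ℤ, i ≠ 0 → Good (i • g))
    {i : ℤ} (hi : i ≠ 0) : f (i • g) = f g ^ i := by
  have hpos : ∀ k : ℕ, f (((k : ℤ) + 1) • g) = f g ^ ((k : ℤ) + 1) := by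
    intro k
    induction k with
    | zero => simp
    | succ k ih =>
      push_cast
      have h2 := hg ((k : ℤ) + 1 + 1) (by omega)
      have h1 := hg ((k : ℤ) + 1) (by omega)
      have h0 := hg 1 one_ne_zero
      rw [one_smul] at h0
      rw [add_smul _ 1 g, one_smul] at h2 ⊢
      rw [hmul _ _ h1 h0 h2, ih, ← zpow_add_one]
  rcases lt_or_gt_of_ne hi with h | h
  · obtain ⟨k, hk⟩ : ∃ k : ℕ, i = -((k : ℤ) + 1) := ⟨(-i - 1).toNat, by omega⟩
    rw [hk, neg_smul, hneg _ (hg _ (by omega)), hpos, zpow_neg]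
  · obtain ⟨k, hk⟩ : ∃ k : ℕ, i = (k : ℤ) + 1 := ⟨(i - 1).toNat, by omega⟩
    rw [hk, hpos]

/-- A function on `ℤ²` that is multiplicative as long as it is evaluated at good vectors agrees
on them with a character, provided that the nonzero multiples of the vectors of some basis are
good. The bases that occur here are `(1, r), (t, 1)` with `rt = 0`. -/
theorem exists_character {G : Type*} [CommGroup G] {Good : (Fin 2 → ℤ) → Prop}
    {f : (Fin 2 → ℤ) → G}
    (hmul : ∀ m n, Good m → Good n → Good (m + n) → f (m + n) = f m * f n)
    (hneg : ∀ m, Good m → f (-m) = (f m)⁻¹) (hgood : ∀ m, Good m → m ≠ 0) {r t : ℤ}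
    (hrt : r * t = 0)
    (h1 : ∀ i : ℤ, i ≠ 0 → Good (i • ![1, r])) (h2 : ∀ i : ℤ, i ≠ 0 → Good (i • ![t, 1])) :
    ∃ x y : G, ∀ m, Good m → f m = x ^ m 0 * y ^ m 1 := by
  refine ⟨f ![1, r] * (f ![t, 1] ^ r)⁻¹, f ![t, 1] * (f ![1, r] ^ t)⁻¹, fun m hm => ?_⟩
  obtain ⟨i, hi⟩ : ∃ i, i = m 0 - t * m 1 := ⟨_, rfl⟩
  obtain ⟨j, hj⟩ : ∃ j, j = m 1 - r * m 0 := ⟨_, rfl⟩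
  have hmij : m = i • ![1, r] + j • ![t, 1] := by
    ext k
    fin_cases k
    · simp [hi, hj]; linear_combination m 0 * hrt
    · simp [hi, hj]; linear_combination m 1 * hrt
  have key : f m = f ![1, r] ^ i * f ![t, 1] ^ j := by
    rcases eq_or_ne i 0 with hi0 | hi0
    · have hj0 : j ≠ 0 := by
        rintro rfl; exact hgood m hm (by rw [hmij, hi0]; simp)
      rw [hmij, hi0, zero_smul, zero_add, zpow_zero, one_mul,
        map_zsmul_of_partial hmul hneg h2 hj0]
    rcases eq_or_ne j 0 with hj0 | hj0
    · rw [hmij, hj0, zero_smul, add_zero, zpow_zero, mul_one,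
        map_zsmul_of_partial hmul hneg h1 hi0]
    · have := hmul _ _ (h1 i hi0) (h2 j hj0) (hmij ▸ hm)
      rw [← hmij] at this
      rw [this, map_zsmul_of_partial hmul hneg h2 hj0, map_zsmul_of_partial hmul hneg h1 hi0]
  rw [key, hi, hj, zpow_sub, zpow_sub, mul_zpow, mul_zpow, inv_zpow, inv_zpow, ← zpow_mul,
    ← zpow_mul]
  simp only [mul_comm, mul_left_comm, mul_assoc]

/-! ### Case `p ≠ 0`: the polynomials `e_m` -/

/-- The brackets `[E(m), E(n)]` in terms of the scalar factors `a` and the constant terms `b`. -/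
theorem OpRel.scalar_rel (H : OpRel p e c) {a : (Fin 2 → ℤ) → ℂˣ} {b : (Fin 2 → ℤ) → ℂ}
    (hab : ∀ n, det2 (toC n) p ≠ 0 → ∀ z,
      MvPolynomial.eval z (e n) = a n * (det2 z (toC n + p) + b n))
    {m n : Fin 2 → ℤ} (hm : det2 (toC m) p ≠ 0) (hn : det2 (toC n) p ≠ 0)
    (hmn : det2 (toC (m + n)) p ≠ 0) :
    (det2 (toC m + p) (toC n + p) ≠ 0 → a (m + n) = a m * a n) ∧
    (det2 (toC m) (toC n) + det2 (toC m) p) * b m +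
      (det2 (toC m) (toC n) - det2 (toC n) p) * b n =
        det2 (toC m + p) (toC n + p) * b (m + n) := by
  have hK : det2 (toC m + p) (toC n + p) =
      det2 (toC m) (toC n) + det2 (toC m) p - det2 (toC n) p := by
    simp only [det2_add_left, det2_add_right, det2_self, det2_swap (toC n) p]; ring
  -- it is enough to look at the two points `0` and `p`
  have h0 := H.EE m n 0
  have hp := H.EE m n p
  rw [hK] at h0 hp ⊢
  rw [hab m hm, hab m hm, hab n hn, hab n hn, hab _ hmn] at h0 hp
  have hz : ∀ v, det2 0 v = 0 := fun v => by simp [det2]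
  simp only [toC_add, det2_sub_left, det2_add_left, det2_add_right, det2_self, hz,
    det2_swap (toC m) p, det2_swap (toC n) p, det2_swap (toC m) (toC n)] at h0 hp hmn
  set μ := det2 (toC m) p
  set ν := det2 (toC n) p
  set D := det2 (toC m) (toC n)
  have key : (D + μ - ν) * ((a (m + n) : ℂ) - a m * a n) = 0 := by
    have : (μ + ν) * ((D + μ - ν) * ((a (m + n) : ℂ) - a m * a n)) = 0 := by
      linear_combination h0 - hp
    exact (mul_eq_zero.1 this).resolve_left hmn
  constructor
  · intro hne
    ext
    rw [Units.val_mul]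
    exact sub_eq_zero.1 ((mul_eq_zero.1 key).resolve_left hne)
  · have : (a m * a n : ℂ) * ((D + μ) * b m + (D - ν) * b n - (D + μ - ν) * b (m + n)) = 0 := by
      linear_combination b (m + n) * key - h0
    exact sub_eq_zero.1 ((mul_eq_zero.1 this).resolve_left
      (mul_ne_zero (a m).ne_zero (a n).ne_zero))

theorem toC_ne_zero_of_det2 {p : Fin 2 → ℂ} {m : Fin 2 → ℤ} (h : det2 (toC m) p ≠ 0) : m ≠ 0 := by
  rintro rfl
  simp [toC_zero, det2] at h

/-- The polynomials `e_m` are the ones of `Ω(λ, α, b)` if `|m, p| ≠ 0`. -/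
theorem OpRel.exists_good_form (H : OpRel p e c) (hp : p ≠ 0) :
    ∃ (lam : Fin 2 → ℂˣ) (α : ℂ), ∀ m, det2 (toC m) p ≠ 0 → ∀ z,
      MvPolynomial.eval z (e m) = lamPow lam m * det2 (z + α • p) (toC m + p) := by
  have hex : ∀ n, ∃ (a : ℂˣ) (b : ℂ), det2 (toC n) p ≠ 0 → ∀ z,
      MvPolynomial.eval z (e n) = a * (det2 z (toC n + p) + b) ∧
      MvPolynomial.eval z (e (-n)) = (a : ℂ)⁻¹ * (det2 z (-toC n + p) - b) := by
    intro n
    by_cases hn : det2 (toC n) p = 0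
    · exact ⟨1, 0, fun h => absurd hn h⟩
    · obtain ⟨a, b, h⟩ := H.exists_affine hn
      exact ⟨a, b, fun _ => h⟩
  choose a b hab' using hex
  have hab : ∀ n, det2 (toC n) p ≠ 0 → ∀ z,
      MvPolynomial.eval z (e n) = a n * (det2 z (toC n + p) + b n) :=
    fun n hn z => (hab' n hn z).1
  have hz : ∀ v, det2 0 v = 0 := fun v => by simp [det2]
  have hgneg : ∀ n, det2 (toC n) p ≠ 0 → det2 (toC (-n)) p ≠ 0 := fun n hn => by
    rwa [toC_neg, det2_neg_left, neg_ne_zero]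
  have haneg : ∀ n, det2 (toC n) p ≠ 0 → a (-n) = (a n)⁻¹ ∧ b (-n) = -b n := by
    intro n hn
    have h0 := (hab' n hn 0).2
    have h1 := (hab' n hn p).2
    rw [hab (-n) (hgneg n hn), toC_neg] at h0 h1
    simp only [hz, det2_add_right, det2_self, det2_neg_right, det2_swap (toC n) p] at h0 h1
    have ha : (a (-n) : ℂ) = (a n : ℂ)⁻¹ := mul_right_cancel₀ hn (by linear_combination h1 - h0)
    refine ⟨by ext; rw [ha, Units.val_inv_eq_inv_val], ?_⟩
    rw [ha] at h0
    exact mul_left_cancel₀ (inv_ne_zero (a n).ne_zero) (by linear_combination h0)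
  -- proportionality of `b` and `|·, p|`
  have hprop : ∀ m n, det2 (toC m) p ≠ 0 → det2 (toC n) p ≠ 0 → det2 (toC (m + n)) p ≠ 0 →
      det2 (toC m) (toC n) - det2 (toC n) p ≠ 0 →
      det2 (toC m) p * b n = det2 (toC n) p * b m := by
    intro m n hm hn hmn hne
    have h1 := (H.scalar_rel hab hm hn hmn).2
    have h2 := (H.scalar_rel hab hmn (hgneg n hn) (by rwa [add_neg_cancel_right])).2
    rw [add_neg_cancel_right, (haneg n hn).2] at h2
    simp only [toC_add, toC_neg, det2_add_left, det2_add_right, det2_self, det2_neg_right,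
      det2_neg_left, det2_swap (toC n) p] at h1 h2
    set μ := det2 (toC m) p
    set ν := det2 (toC n) p
    set D := det2 (toC m) (toC n)
    have : 2 * (D - ν) * (μ * b n - ν * b m) = 0 := by
      linear_combination (μ + ν - D) * h1 + (D + μ - ν) * h2
    exact sub_eq_zero.1 ((mul_eq_zero.1 this).resolve_left (mul_ne_zero two_ne_zero hne))
  obtain ⟨n₀, hn₀⟩ := exists_forall_ne_zero [fun m => det2 (toC m) p] (by
    simpa using isAff_of_eq p 0 (.inl hp) (by simp))
  simp only [List.forall_mem_cons, List.not_mem_nil, false_imp_iff, implies_true, and_true] at hn₀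
  have hb : ∀ n, det2 (toC n) p ≠ 0 → b n = b n₀ / det2 (toC n₀) p * det2 (toC n) p := by
    intro n hn
    obtain ⟨k, hk⟩ := exists_forall_ne_zero
      [fun k => det2 (toC k) p, fun k => det2 (toC (k + n)) p, fun k => det2 (toC (k + n₀)) p,
        fun k => det2 (toC k) (toC n) - det2 (toC n) p,
        fun k => det2 (toC k) (toC n₀) - det2 (toC n₀) p] (by
      simp only [List.forall_mem_cons, List.not_mem_nil, false_imp_iff, implies_true, and_true]
      exact ⟨isAff_of_eq p 0 (.inl hp) (by simp),
        isAff_of_eq p (det2 (toC n) p) (.inl hp) fun k => by rw [toC_add, det2_add_left],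
        isAff_of_eq p (det2 (toC n₀) p) (.inl hp) fun k => by rw [toC_add, det2_add_left],
        isAff_of_eq _ _ (.inr (neg_ne_zero.2 hn)) fun k => sub_eq_add_neg _ _,
        isAff_of_eq _ _ (.inr (neg_ne_zero.2 hn₀)) fun k => sub_eq_add_neg _ _⟩)
    simp only [List.forall_mem_cons, List.not_mem_nil, false_imp_iff, implies_true,
      and_true] at hk
    obtain ⟨k1, k2, k3, k4, k5⟩ := hk
    have e1 := hprop k n k1 hn k2 k4
    have e2 := hprop k n₀ k1 hn₀ k3 k5
    refine mul_left_cancel₀ k1 ?_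
    rw [div_mul_eq_mul_div, ← mul_div_assoc, eq_div_iff hn₀]
    linear_combination det2 (toC n₀) p * e1 - det2 (toC n) p * e2
  -- a generic `k` removes the exceptional pairs from the multiplicativity of `a`
  have hmul : ∀ m n, det2 (toC m) p ≠ 0 → det2 (toC n) p ≠ 0 → det2 (toC (m + n)) p ≠ 0 →
      a (m + n) = a m * a n := by
    intro m n hm hn hmn
    obtain ⟨k, hk⟩ := exists_forall_ne_zero
      [fun k => det2 (toC k) p, fun k => det2 (toC (n + k)) p, fun k => det2 (toC (m + n + k)) p,
        fun k => det2 (toC (m + n) + p) (toC k + p), fun k => det2 (toC m + p) (toC (n + k) + p),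
        fun k => det2 (toC n + p) (toC k + p)] (by
      simp only [List.forall_mem_cons, List.not_mem_nil, false_imp_iff, implies_true, and_true]
      have key : ∀ m, det2 (toC m) p ≠ 0 → -(toC m + p) ≠ 0 := fun m hm =>
        neg_ne_zero.2 (add_ne_zero_of_det2 hm)
      refine ⟨isAff_of_eq p 0 (.inl hp) (by simp),
        isAff_of_eq p (det2 (toC n) p) (.inl hp) fun k => by
          rw [toC_add, det2_add_left, add_comm],
        isAff_of_eq p (det2 (toC (m + n)) p) (.inl hp) fun k => by
          rw [toC_add, det2_add_left, add_comm],
        isAff_of_eq (-(toC (m + n) + p)) (det2 (toC (m + n) + p) p) (.inl (key _ hmn)) fun k => ?_,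
        isAff_of_eq (-(toC m + p)) (det2 (toC m + p) (toC n + p)) (.inl (key _ hm)) fun k => ?_,
        isAff_of_eq (-(toC n + p)) (det2 (toC n + p) p) (.inl (key _ hn)) fun k => ?_⟩
      · rw [det2_add_right _ (toC k) p, det2_neg_right, ← det2_swap]
      · rw [toC_add, add_right_comm, det2_add_right _ _ (toC k), det2_neg_right, ← det2_swap,
          add_comm]
      · rw [det2_add_right _ (toC k) p, det2_neg_right, ← det2_swap])
    simp only [List.forall_mem_cons, List.not_mem_nil, false_imp_iff, implies_true,
      and_true] at hk
    obtain ⟨k1, k2, k3, k4, k5, k6⟩ := hk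
    have e1 := (H.scalar_rel hab hmn k1 k3).1 k4
    have e2 := (H.scalar_rel hab hm k2 (by rwa [← add_assoc])).1 k5
    have e3 := (H.scalar_rel hab hn k1 k2).1 k6
    rw [add_assoc, e2, e3, ← mul_assoc] at e1
    exact (mul_right_cancel e1).symm
  have hsmul : ∀ g : Fin 2 → ℤ, det2 (toC g) p ≠ 0 → ∀ i : ℤ, i ≠ 0 →
      det2 (toC (i • g)) p ≠ 0 := by
    intro g hg i hi
    have : toC (i • g) = (i : ℂ) • toC g := by ext; simp [toC]
    rw [this, det2_smul_left]
    exact mul_ne_zero (Int.cast_ne_zero.2 hi) hg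
  -- a basis of `ℤ²` off the line spanned by `p`
  obtain ⟨r, t, hrt, h1, h2⟩ : ∃ r t : ℤ, r * t = 0 ∧ det2 (toC ![1, r]) p ≠ 0 ∧
      det2 (toC ![t, 1]) p ≠ 0 := by
    by_cases h0 : p 0 = 0
    · have h1 : p 1 ≠ 0 := fun h1 => hp (by ext i; fin_cases i <;> simp [h0, h1])
      exact ⟨0, 1, by simp, by simpa [det2, toC] using h1, by simpa [det2, toC, h0] using h1⟩
    · by_cases h1 : p 1 = 0
      · exact ⟨1, 0, by simp, by simpa [det2, toC, h1] using h0, by simpa [det2, toC] using h0⟩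
      · exact ⟨0, 0, by simp, by simpa [det2, toC] using h1, by simpa [det2, toC] using h0⟩
  obtain ⟨x, y, hxy⟩ := exists_character (Good := fun m => det2 (toC m) p ≠ 0) hmul
    (fun m hm => (haneg m hm).1) (fun m => toC_ne_zero_of_det2) hrt (hsmul _ h1) (hsmul _ h2)
  refine ⟨![x, y], -(b n₀ / det2 (toC n₀) p), fun m hm z => ?_⟩
  rw [hab m hm, hb m hm, hxy m hm]
  simp only [lamPow, Matrix.cons_val_zero, Matrix.cons_val_one, det2_add_left, det2_smul_left,
    det2_add_right, det2_self, det2_swap (toC m) p]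
  ring

/-- Only the zero polynomial vanishes on all the lines `|z + αp, n + p| = 0` with `|n, p| ≠ 0`. This
determines `e_m` and `c_m` for the vectors `m` parallel to `p`, which are not always accessible as
brackets: on these lines one of the two terms of the bracket with `E(n)` vanishes. -/
theorem eq_zero_of_forall_line (hp : p ≠ 0) (α : ℂ) {f : Uh}
    (h : ∀ n, det2 (toC n) p ≠ 0 → ∀ z, det2 (z + α • p) (toC n + p) = 0 →
      MvPolynomial.eval z f = 0) : f = 0 := by
  -- the points `n + p - αp` already suffice
  have hg : shift (α • p - p) f * (MvPolynomial.C (p 1) * MvPolynomial.X 0 -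
      MvPolynomial.C (p 0) * MvPolynomial.X 1) = 0 := by
    refine eq_zero_of_eval_int fun n => ?_
    rw [map_mul, eval_shift]
    by_cases hn : det2 (toC n) p = 0
    · rw [mul_eq_zero]
      right
      rw [← hn]
      simp [det2, toC]
      ring
    · rw [h n hn, zero_mul]
      rw [show toC n - (α • p - p) + α • p = toC n + p by module, det2_self]
  have h2 : (MvPolynomial.C (p 1) * MvPolynomial.X 0 -
      MvPolynomial.C (p 0) * MvPolynomial.X 1 : Uh) ≠ 0 := by
    intro h0
    refine hp ?_
    ext i
    fin_cases i
    · simpa using congrArg (MvPolynomial.eval ![0, 1]) h0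
    · simpa using congrArg (MvPolynomial.eval ![1, 0]) h0
  have h3 := (mul_eq_zero.1 hg).resolve_right h2
  have h4 := shift_shift (-(α • p - p)) (α • p - p) f
  rwa [h3, map_zero, neg_add_cancel, shift_zero, eq_comm] at h4

/-- If `p ≠ 0`, all the polynomials `e_m` are the ones of `Ω(λ, α, b)`. -/
theorem OpRel.exists_form (H : OpRel p e c) (hp : p ≠ 0) :
    ∃ (lam : Fin 2 → ℂˣ) (α : ℂ), ∀ m z,
      MvPolynomial.eval z (e m) = lamPow lam m * det2 (z + α • p) (toC m + p) := by
  obtain ⟨lam, α, hgood⟩ := H.exists_good_form hp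
  refine ⟨lam, α, fun m => ?_⟩
  by_cases hm : det2 (toC m) p = 0
  swap
  · exact hgood m hm
  rcases eq_or_ne m 0 with rfl | hm0
  · intro z
    rw [H.zero, lamPow_zero, toC_zero, zero_add, det2_add_left, det2_smul_left, det2_self]
    ring
  set g : Uh := MvPolynomial.C (lamPow lam m) * linPoly (toC m + p) (α • p) with hg
  have hge : ∀ z, MvPolynomial.eval z g = lamPow lam m * det2 (z + α • p) (toC m + p) := by
    intro z
    simp only [hg, linPoly, det2, map_mul, map_sub, map_add, MvPolynomial.eval_C,
      MvPolynomial.eval_X, Pi.add_apply]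
    ring
  have hf : e m - g = 0 := by
    refine eq_zero_of_forall_line hp α fun n hn z hz => ?_
    have hmn : det2 (toC (m + n)) p ≠ 0 := by rwa [toC_add, det2_add_left, hm, zero_add]
    have h1 := H.EE m n z
    rw [hgood n hn, hgood n hn, hgood _ hmn, hz, mul_zero, mul_zero, sub_zero] at h1
    -- `m` is a nonzero vector parallel to `p`, so `|m, n|` does not vanish
    have hD : det2 (toC m) (toC n) ≠ 0 := by
      intro hD
      have := eq_add_smul_of_det2_ne_zero hn (toC m)
      rw [hD, hm] at this
      refine hm0 (funext fun i => ?_)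
      have := congrFun this i
      simpa [toC] using this
    have hz' : det2 (z - toC m + α • p) (toC n + p) = -det2 (toC m) (toC n) := by
      rw [show z - toC m + α • p = z + α • p - toC m by module, det2_sub_left, hz, det2_add_right,
        hm]
      ring
    have hz'' : det2 (z + α • p) (toC (m + n) + p) = det2 (z + α • p) (toC m + p) -
        det2 (z + α • p) p := by
      have : toC (m + n) + p = (toC m + p) + (toC n + p) + -p := by rw [toC_add]; module
      rw [this, det2_add_right, det2_add_right, hz, det2_neg_right]; ring
    -- `m` is the multiple `|m, n| / |p, n|` of `p`
    have hpar : det2 (toC m) (toC n) * det2 (z + α • p) p =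
        -det2 (toC n) p * det2 (z + α • p) (toC m) := by
      have := eq_add_smul_of_det2_ne_zero hn (toC m)
      rw [hm, zero_div, zero_smul, add_zero] at this
      conv_rhs => rw [this, det2_smul_right]
      field_simp
    have hK : det2 (toC m + p) (toC n + p) = det2 (toC m) (toC n) - det2 (toC n) p := by
      simp only [det2_add_left, det2_add_right, det2_self, hm, det2_swap (toC n) p]; ring
    rw [hz', hz'', hK, lamPow_add] at h1
    rw [map_sub, hge, sub_eq_zero]
    have hl : lamPow lam n ≠ 0 := (lam 0 ^ n 0 * lam 1 ^ n 1).ne_zero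
    refine mul_left_cancel₀ (mul_ne_zero hl hD) ?_
    rw [det2_add_right (z + α • p) (toC m) p] at h1 ⊢
    linear_combination -h1 - lamPow lam m * lamPow lam n * hpar
  intro z
  rw [sub_eq_zero.1 hf, hge]

/-! ### Case `p ≠ 0`: the polynomials `c_m` -/

theorem lamPow_ne_zero (lam : Fin 2 → ℂˣ) (m : Fin 2 → ℤ) : lamPow lam m ≠ 0 :=
  (lam 0 ^ m 0 * lam 1 ^ m 1).ne_zero

theorem lamPow_neg (lam : Fin 2 → ℂˣ) (m : Fin 2 → ℤ) : lamPow lam (-m) = (lamPow lam m)⁻¹ := by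
  refine eq_inv_of_mul_eq_one_left ?_
  rw [← lamPow_add, neg_add_cancel, lamPow_zero]

/-- If `|m, p| ≠ 0`, then `c_m` is invariant under translation in a generic direction. -/
theorem OpRel.exists_const_direction (H : OpRel p e c) {lam : Fin 2 → ℂˣ} {α : ℂ}
    (he : ∀ m z, MvPolynomial.eval z (e m) = lamPow lam m * det2 (z + α • p) (toC m + p))
    {m : Fin 2 → ℤ} (hm : det2 (toC m) p ≠ 0) {v : Fin 2 → ℂ} (hv : v ≠ 0) :
    ∃ n, det2 (toC n) v ≠ 0 ∧
      ∀ z (s : ℂ), MvPolynomial.eval (z + s • toC n) (c m) = MvPolynomial.eval z (c m) := by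
  have hp := ne_zero_of_det2_right hm
  obtain ⟨n, hn⟩ := exists_forall_ne_zero
    ([fun n => det2 (toC n) v, fun n => det2 (toC n) p, fun n => det2 (toC m + p) (toC n + p)] ++
      (List.range ((c m).totalDegree + 1)).map
        fun (d : ℕ) n => det2 (toC n) (-((2 : ℂ) • toC m + ((d : ℂ) + 3) • p))) (by
    simp only [List.forall_mem_append, List.forall_mem_cons, List.not_mem_nil, false_imp_iff,
      implies_true, and_true, List.forall_mem_map]
    refine ⟨⟨isAff_of_eq v 0 (.inl hv) (by simp), isAff_of_eq p 0 (.inl hp) (by simp),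
      isAff_of_eq (-(toC m + p)) (det2 (toC m + p) p)
        (.inl (neg_ne_zero.2 (add_ne_zero_of_det2 hm))) fun k => ?_⟩,
      fun d _ => isAff_of_eq _ 0 (.inl ?_) fun k => (add_zero _).symm⟩
    · rw [det2_add_right _ (toC k) p, det2_neg_right, ← det2_swap]
    · refine neg_ne_zero.2 (ne_zero_of_det2_left (v := p) ?_)
      rw [det2_add_left, det2_smul_left, det2_smul_left, det2_self, mul_zero, add_zero]
      exact mul_ne_zero two_ne_zero hm)
  simp only [List.forall_mem_append, List.forall_mem_cons, List.not_mem_nil, false_imp_iff,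
      implies_true, and_true, List.forall_mem_map] at hn
  obtain ⟨⟨n1, n2, n3⟩, n4⟩ := hn
  refine ⟨n, n1, fun z s => ?_⟩
  suffices h : (line z (toC n) (c m)).natDegree = 0 by
    obtain ⟨x, hx⟩ := Polynomial.natDegree_eq_zero.1 h
    have e1 := eval_line z (toC n) (c m) s
    have e2 := eval_line z (toC n) (c m) 0
    rw [← hx, Polynomial.eval_C] at e1 e2
    rw [zero_smul, add_zero] at e2
    rw [← e1, e2]
  by_cases h0 : line z (toC n) (c m) = 0
  · rw [h0, Polynomial.natDegree_zero]
  have key := string_dichotomy (e := e) (lamPow_ne_zero lam n) (m := m)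
    (P := Polynomial.X + Polynomial.C (α * det2 p (toC n))) (x := c m) (y := c (m + n))
    (q := toC m + p)
    (fun z => by
      rw [he, he, lamPow_neg, toC_neg]
      simp only [Polynomial.eval_add, Polynomial.eval_X, Polynomial.eval_C, det2_add_left,
        det2_add_right, det2_smul_left, det2_self, det2_neg_right]
      constructor <;> ring)
    (by rw [det2_add_left, det2_self, add_zero]) (H.tE m n)
    (fun z => by
      have := H.tE (m + n) (-n) z
      rw [add_neg_cancel_right] at this
      rwa [add_right_comm, ← toC_add])
    n3 z h0
  have hd := natDegree_line_le z (toC n) (c m)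
  set d := (line z (toC n) (c m)).natDegree
  simp only [Polynomial.eval_add, Polynomial.eval_X, Polynomial.eval_C, det2_add_left,
    det2_swap (toC n) p] at key
  rcases key with h | h
  · have : (d : ℂ) * det2 (toC n) p = 0 := by linear_combination -h
    exact_mod_cast (mul_eq_zero.1 this).resolve_right n2
  · refine absurd ?_ (n4 d (List.mem_range.2 (Nat.lt_succ_of_le hd)))
    rw [det2_neg_right, det2_add_right, det2_smul_right, det2_smul_right,
      det2_swap (toC m) (toC n)]
    linear_combination h

/-- If `p ≠ 0`, the polynomials `c_m` are the constants of `Ω(λ, α, b)`. The value `b` is transported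
from one vector `m` to all others by brackets with `E(n)`; only `m = -2p` is out of reach and needs
the argument with infinitely many lines. -/
theorem OpRel.exists_form_t (H : OpRel p e c) (hp : p ≠ 0) {lam : Fin 2 → ℂˣ} {α : ℂ}
    (he : ∀ m z, MvPolynomial.eval z (e m) = lamPow lam m * det2 (z + α • p) (toC m + p)) :
    ∃ b, ∀ m z, MvPolynomial.eval z (c m) = lamPow lam m * b := by
  have hconst : ∀ m, det2 (toC m) p ≠ 0 → ∀ z,
      MvPolynomial.eval z (c m) = MvPolynomial.eval 0 (c m) := by
    intro m hm z
    obtain ⟨n, hn, h1⟩ := H.exists_const_direction he hm hp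
    obtain ⟨k, hk, h2⟩ := H.exists_const_direction he hm (ne_zero_of_det2_left hn)
    have hz := eq_add_smul_of_det2_ne_zero hk z
    rw [hz, h2, ← zero_add (_ • toC n), h1]
  -- if `c_m` is constant, or on the line `|z + αp, n + p| = 0`, the bracket with `E(n)` just
  -- carries the value of `λ^{-m} c_m` to `λ^{-m-n} c_{m+n}`
  have hstep : ∀ m n z, MvPolynomial.eval (z - toC n) (c m) * det2 (z + α • p) (toC n + p) =
      MvPolynomial.eval z (c m) * det2 (z + α • p) (toC n + p) →
      det2 (toC m + p) (toC n + p) ≠ 0 →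
      MvPolynomial.eval z (c (m + n)) = lamPow lam n * MvPolynomial.eval z (c m) := by
    intro m n z h hne
    have h1 := H.tE m n z
    rw [he, he, show z - (toC m + p) + α • p = z + α • p - (toC m + p) by module,
      det2_sub_left] at h1
    exact mul_left_cancel₀ hne (by linear_combination h1 + lamPow lam n * h)
  obtain ⟨m₀, hm₀⟩ := exists_forall_ne_zero [fun m => det2 (toC m) p] (by
    simpa using isAff_of_eq p 0 (.inl hp) (by simp))
  simp only [List.forall_mem_cons, List.not_mem_nil, false_imp_iff, implies_true, and_true] at hm₀
  set b := (lamPow lam m₀)⁻¹ * MvPolynomial.eval 0 (c m₀) with hb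
  have hgood : ∀ m z, toC m + (2 : ℂ) • p ≠ 0 → MvPolynomial.eval z (c m) = lamPow lam m * b := by
    intro m z hm
    obtain ⟨k, hk⟩ := exists_forall_ne_zero
      [fun k => det2 (toC k) p, fun k => det2 (toC m₀ + p) (toC (k - m₀) + p),
        fun k => det2 (toC k + p) (toC (m - k) + p)] (by
      simp only [List.forall_mem_cons, List.not_mem_nil, false_imp_iff, implies_true, and_true]
      refine ⟨isAff_of_eq p 0 (.inl hp) (by simp),
        isAff_of_eq (-(toC m₀ + p)) (det2 (toC m₀ + p) (-toC m₀ + p))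
          (.inl (neg_ne_zero.2 (add_ne_zero_of_det2 hm₀))) fun k => ?_,
        isAff_of_eq (toC m + (2 : ℂ) • p) (det2 p (toC m + p)) (.inl hm) fun k => ?_⟩
      · rw [sub_eq_add_neg, toC_add, toC_neg, add_assoc, det2_add_right, det2_neg_right,
          ← det2_swap]
      · rw [sub_eq_add_neg, toC_add, toC_neg]
        simp only [det2_add_right, det2_add_left, det2_neg_right, det2_smul_right, det2_self,
          det2_swap (toC k) p]
        ring)
    simp only [List.forall_mem_cons, List.not_mem_nil, false_imp_iff, implies_true,
      and_true] at hk
    obtain ⟨k1, k2, k3⟩ := hk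
    have e1 := hstep m₀ (k - m₀) 0 (by rw [hconst m₀ hm₀ (0 - _)]) k2
    have e2 := hstep k (m - k) z (by rw [hconst k k1 (z - _), hconst k k1 z]) k3
    rw [add_sub_cancel] at e1 e2
    rw [e2, hconst k k1, e1, hb]
    simp only [sub_eq_add_neg, lamPow_add, lamPow_neg]
    have := lamPow_ne_zero lam k
    field_simp
  refine ⟨b, fun m => ?_⟩
  by_cases hm : toC m + (2 : ℂ) • p = 0
  swap
  · exact fun z => hgood m z hm
  have hm' : toC m = -((2 : ℂ) • p) := eq_neg_of_add_eq_zero_left hm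
  have hf : c m - MvPolynomial.C (lamPow lam m * b) = 0 := by
    refine eq_zero_of_forall_line hp α fun n hn z hz => ?_
    have hn0 : toC (m + n) + (2 : ℂ) • p ≠ 0 := by
      rw [toC_add, add_right_comm, hm, zero_add]
      exact ne_zero_of_det2_left hn
    have h1 := hstep m n z (by rw [hz, mul_zero, mul_zero]) (by
      rw [hm', show -((2 : ℂ) • p) + p = -p by module, det2_neg_left, det2_add_right, det2_self,
        add_zero, det2_swap, neg_neg]
      exact hn)
    rw [hgood _ z hn0, lamPow_add] at h1
    rw [map_sub, MvPolynomial.eval_C]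
    exact mul_left_cancel₀ (lamPow_ne_zero lam n) (by linear_combination -h1)
  intro z
  rw [sub_eq_zero.1 hf, MvPolynomial.eval_C]

end nonzero

/-! ### Case `p = 0`: the polynomials `e_m` -/

section zero

variable {e c : (Fin 2 → ℤ) → Uh}

theorem toC_ne_zero {m : Fin 2 → ℤ} (hm : m ≠ 0) : toC m ≠ 0 := by
  intro h
  refine hm (funext fun i => ?_)
  simpa [toC] using congrFun h i

theorem ne_zero_of_det2_toC {m n : Fin 2 → ℤ} (h : det2 (toC m) (toC n) ≠ 0) :
    m ≠ 0 ∧ n ≠ 0 ∧ m + n ≠ 0 := by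
  refine ⟨?_, ?_, fun h0 => ?_⟩
  · rintro rfl; simp [toC_zero, det2] at h
  · rintro rfl; simp [toC_zero, det2] at h
  · rw [add_eq_zero_iff_eq_neg.1 h0, toC_neg, det2_neg_left, det2_self, neg_zero] at h
    exact h rfl

theorem exists_det2_eq_one {v : Fin 2 → ℂ} (hv : v ≠ 0) : ∃ q, det2 q v = 1 := by
  by_cases h1 : v 1 = 0
  · have h0 : v 0 ≠ 0 := fun h0 => hv (by ext i; fin_cases i <;> simp [h0, h1])
    exact ⟨![0, -(v 0)⁻¹], by simp [det2, h0]⟩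
  · exact ⟨![(v 1)⁻¹, 0], by simp [det2, h1]⟩

/-- A polynomial that is invariant under translation in the direction `v` is a polynomial in the
linear form `|z, v|`. -/
theorem exists_eval_eq_of_invariant {f : Uh} {v : Fin 2 → ℂ} (hv : v ≠ 0)
    (h : ∀ z, MvPolynomial.eval (z - v) f = MvPolynomial.eval z f) :
    ∃ P : Polynomial ℂ, ∀ z, MvPolynomial.eval z f = P.eval (det2 z v) := by
  have hinv : ∀ z (s : ℂ), MvPolynomial.eval (z + s • v) f = MvPolynomial.eval z f := by
    intro z s
    have := eval_eq_of_periodic (P := line z v f) one_ne_zero (fun s => by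
      rw [eval_line, eval_line, ← h]
      congr 2
      module) s
    rwa [eval_line, eval_line, zero_smul, add_zero] at this
  obtain ⟨q, hq⟩ := exists_det2_eq_one hv
  refine ⟨line 0 q f, fun z => ?_⟩
  have hz := eq_add_smul_of_det2_ne_zero (hq ▸ one_ne_zero) z
  rw [hq, div_one, div_one, add_comm] at hz
  rw [eval_line, zero_add]
  conv_lhs => rw [hz, hinv]

/-- The point with prescribed values of the linear forms `|z, u|` and `|z, v|`. -/
theorem exists_det2_eq {u v : Fin 2 → ℂ} (h : det2 u v ≠ 0) (x y : ℂ) :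
    ∃ z, det2 z u = x ∧ det2 z v = y := by
  refine ⟨(y / det2 u v) • u + (-(x / det2 u v)) • v, ?_, ?_⟩
  · rw [det2_add_left, det2_smul_left, det2_smul_left, det2_self, det2_swap u v]
    field_simp
    ring
  · rw [det2_add_left, det2_smul_left, det2_smul_left, det2_self]
    field_simp
    ring

theorem OpRel.EE_zero (H : OpRel 0 e c) (m n : Fin 2 → ℤ) (z : Fin 2 → ℂ) :
    MvPolynomial.eval (z - toC m) (e n) * MvPolynomial.eval z (e m) -
      MvPolynomial.eval (z - toC n) (e m) * MvPolynomial.eval z (e n) =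
        -det2 (toC m) (toC n) * MvPolynomial.eval z (e (m + n)) := by
  simpa using H.EE m n z

/-- If `E(n) = 0`, then `E(k) = 0` for all `k` that are not parallel to `n`, being brackets with
`E(n)`; the remaining `E(m)` are brackets of these. -/
theorem OpRel.E_ne_zero (H : OpRel 0 e c) (hne : ∃ m, e m ≠ 0) {n : Fin 2 → ℤ} (hn : n ≠ 0) :
    e n ≠ 0 := by
  intro h
  obtain ⟨m, hm⟩ := hne
  have hm0 : m ≠ 0 := by
    rintro rfl
    refine hm (MvPolynomial.funext fun z => ?_)
    rw [H.zero, map_zero]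
    simp [det2]
  have hoff : ∀ k, det2 (toC k) (toC n) ≠ 0 → e k = 0 := by
    intro k hk
    refine MvPolynomial.funext fun z => ?_
    have := H.EE_zero (k - n) n z
    rw [h, sub_add_cancel, map_zero, sub_eq_add_neg k, toC_add, toC_neg, det2_add_left,
      det2_neg_left, det2_self] at this
    simp only [map_zero, mul_zero, zero_mul, sub_zero, neg_zero, add_zero] at this ⊢
    exact (mul_eq_zero.1 this.symm).resolve_left (neg_ne_zero.2 hk)
  obtain ⟨k, hk⟩ := exists_forall_ne_zero
    [fun k => det2 (toC k) (toC n), fun k => det2 (toC (m - k)) (toC n),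
      fun k => det2 (toC k) (toC m)] (by
    simp only [List.forall_mem_cons, List.not_mem_nil, false_imp_iff, implies_true, and_true]
    exact ⟨isAff_of_eq (toC n) 0 (.inl (toC_ne_zero hn)) (by simp),
      isAff_of_eq (-toC n) (det2 (toC m) (toC n)) (.inl (neg_ne_zero.2 (toC_ne_zero hn)))
        fun k => by
          rw [sub_eq_add_neg, toC_add, toC_neg, det2_add_left, det2_neg_left, det2_neg_right,
            add_comm],
      isAff_of_eq (toC m) 0 (.inl (toC_ne_zero hm0)) (by simp)⟩)
  simp only [List.forall_mem_cons, List.not_mem_nil, false_imp_iff, implies_true, and_true] at hk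
  obtain ⟨k1, k2, k3⟩ := hk
  refine hm (MvPolynomial.funext fun z => ?_)
  have := H.EE_zero k (m - k) z
  rw [hoff k k1, hoff _ k2, add_sub_cancel, sub_eq_add_neg m, toC_add, toC_neg, det2_add_right,
    det2_neg_right, det2_self] at this
  simp only [map_zero, mul_zero, sub_zero, neg_zero, add_zero] at this ⊢
  exact (mul_eq_zero.1 this.symm).resolve_left (neg_ne_zero.2 k3)

/-- Since `E(n)` and `E(-n)` commute, the product `e_{-n}(z) e_n(z + n)` is periodic along lines in
the direction `n`; so it is constant there, and with it `e_n`. -/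
theorem OpRel.E_invariant (H : OpRel 0 e c) (hne : ∃ m, e m ≠ 0) {n : Fin 2 → ℤ} (hn : n ≠ 0)
    (z : Fin 2 → ℂ) :
    MvPolynomial.eval (z - toC n) (e n) = MvPolynomial.eval z (e n) := by
  suffices h : (shift (-toC n) (e n) - e n) * e (-n) = 0 by
    have h0 := (mul_eq_zero.1 h).resolve_right (H.E_ne_zero hne (neg_ne_zero.2 hn))
    have := congrArg (MvPolynomial.eval (z - toC n)) h0
    rw [map_sub, eval_shift, map_zero, sub_neg_eq_add, sub_add_cancel] at this
    exact (sub_eq_zero.1 this).symm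
  refine MvPolynomial.funext fun z => ?_
  set E := line z (toC n) (e n) with hE
  set E' := line z (toC n) (e (-n)) with hE'
  have e0 := eval_line z (toC n) (e n) 0
  have e0' := eval_line z (toC n) (e (-n)) 0
  have e1 := eval_line z (toC n) (e n) 1
  rw [zero_smul, add_zero, ← hE] at e0
  rw [zero_smul, add_zero, ← hE'] at e0'
  rw [one_smul, ← hE] at e1
  rw [map_mul, map_sub, eval_shift, sub_neg_eq_add, ← e0, ← e1, ← e0', map_zero]
  have hper := eval_eq_of_periodic (P := E' * Polynomial.taylor 1 E) one_ne_zero (fun s => by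
    have := H.EE_zero n (-n) (z + (s + 1) • toC n)
    rw [toC_neg, det2_neg_right, det2_self,
      show z + (s + 1) • toC n - toC n = z + s • toC n by module,
      show z + (s + 1) • toC n - -toC n = z + (s + 1 + 1) • toC n by module, ← eval_line,
      ← eval_line, ← eval_line, ← eval_line] at this
    simp only [Polynomial.eval_mul, Polynomial.taylor_eval]
    linear_combination -this)
  by_cases hG : E' * Polynomial.taylor 1 E = 0
  · rcases mul_eq_zero.1 hG with h | h
    · rw [h, Polynomial.eval_zero, mul_zero]
    · rw [Polynomial.taylor_eq_zero] at h
      rw [h]; simp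
  · have hdeg : (E' * Polynomial.taylor 1 E).natDegree = 0 := by
      have : E' * Polynomial.taylor 1 E =
          Polynomial.C ((E' * Polynomial.taylor 1 E).eval 0) := by
        refine Polynomial.funext fun s => ?_
        rw [hper, Polynomial.eval_C]
      rw [this, Polynomial.natDegree_C]
    rw [Polynomial.natDegree_mul (left_ne_zero_of_mul hG) (right_ne_zero_of_mul hG),
      Polynomial.natDegree_taylor] at hdeg
    obtain ⟨x, hx⟩ := Polynomial.natDegree_eq_zero.1 (show E.natDegree = 0 by omega)
    rw [← hx]; simp

/-- For `m ≠ 0`, the polynomial `e_m` is affine in the linear form `|z, m|`. -/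
theorem OpRel.exists_affine_zero (H : OpRel 0 e c) (hne : ∃ m, e m ≠ 0) {m : Fin 2 → ℤ}
    (hm : m ≠ 0) : ∃ A B, ∀ z, MvPolynomial.eval z (e m) = A * det2 z (toC m) + B := by
  have hP : ∀ n, n ≠ 0 → ∃ P : Polynomial ℂ, ∀ z,
      MvPolynomial.eval z (e n) = P.eval (det2 z (toC n)) := fun n hn =>
    exists_eval_eq_of_invariant (toC_ne_zero hn) (H.E_invariant hne hn)
  obtain ⟨n, hn⟩ := exists_forall_ne_zero [fun n => det2 (toC n) (toC m)] (by
    simpa using isAff_of_eq (toC m) 0 (.inl (toC_ne_zero hm)) (by simp))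
  simp only [List.forall_mem_cons, List.not_mem_nil, false_imp_iff, implies_true, and_true] at hn
  have hD : det2 (toC m) (toC n) ≠ 0 := by rwa [det2_swap, neg_ne_zero]
  obtain ⟨-, hn0, hmn0⟩ := ne_zero_of_det2_toC hD
  obtain ⟨P, hPm⟩ := hP m hm
  obtain ⟨Q, hQn⟩ := hP n hn0
  obtain ⟨R, hRmn⟩ := hP _ hmn0
  set D := det2 (toC m) (toC n) with hDdef
  have hrel : ∀ x y, P.eval x * Q.eval (y + -D) - P.eval (x + D) * Q.eval y =
      -D * R.eval (y + x) := by
    intro x y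
    obtain ⟨z, hx, hy⟩ := exists_det2_eq hD x y
    have := H.EE_zero m n z
    rw [hPm, hPm, hQn, hQn, hRmn, toC_add, det2_add_right, det2_sub_left, det2_sub_left, hx, hy,
      det2_swap (toC m) (toC n), ← hDdef, sub_neg_eq_add, sub_eq_add_neg y, add_comm x y] at this
    linear_combination this
  -- compare the coefficients of `y ^ d`, where `d` is the degree of `Q`
  have hQ : Q ≠ 0 := by
    rintro rfl
    refine H.E_ne_zero hne hn0 (MvPolynomial.funext fun z => ?_)
    rw [hQn, Polynomial.eval_zero, map_zero]
  have hlead : Q.coeff Q.natDegree ≠ 0 := by simpa using hQ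
  have hcoeff : ∀ x, (Polynomial.C (-D) * Polynomial.taylor x R).natDegree ≤ Q.natDegree ∧
      (Polynomial.C (-D) * Polynomial.taylor x R).coeff Q.natDegree =
        Q.coeff Q.natDegree * (0 * -D * Q.natDegree + P.eval x - P.eval (x + D)) := by
    intro x
    refine shiftOp_coeff le_rfl fun y => ?_
    rw [Polynomial.eval_mul, Polynomial.eval_C, Polynomial.taylor_eval, ← hrel]
    ring
  have hR : R.natDegree ≤ Q.natDegree := by
    have := (hcoeff 0).1
    rwa [Polynomial.natDegree_C_mul (neg_ne_zero.2 hD), Polynomial.natDegree_taylor] at this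
  have haff := exists_affine_of_sub_const (P := P) hD
    (c := D * R.coeff Q.natDegree / Q.coeff Q.natDegree) (fun x => by
      have := (hcoeff x).2
      rw [Polynomial.coeff_C_mul, taylor_coeff_top hR] at this
      rw [eq_div_iff hlead]
      linear_combination this)
  exact ⟨_, _, fun z => by rw [hPm, haff]⟩

/-- If not all `E(m)` act as zero, then the polynomials `e_m` are the ones of `Ω(λ, β, b, k)`. -/
theorem OpRel.exists_form_zero (H : OpRel 0 e c) (hne : ∃ m, e m ≠ 0) :
    ∃ (lam : Fin 2 → ℂˣ) (β : Fin 2 → ℂ), ∀ m z,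
      MvPolynomial.eval z (e m) = lamPow lam m * det2 (z + β) (toC m) := by
  have hex : ∀ m, ∃ A B, m ≠ 0 → ∀ z, MvPolynomial.eval z (e m) = A * det2 z (toC m) + B := by
    intro m
    by_cases hm : m = 0
    · exact ⟨0, 0, fun h => absurd hm h⟩
    · obtain ⟨A, B, h⟩ := H.exists_affine_zero hne hm
      exact ⟨A, B, fun _ => h⟩
  choose A B hAB using hex
  have hmulAB : ∀ m n, det2 (toC m) (toC n) ≠ 0 →
      A (m + n) = A m * A n ∧ B (m + n) = A n * B m + A m * B n := by
    intro m n hD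
    obtain ⟨hm, hn, hmn⟩ := ne_zero_of_det2_toC hD
    have hrel : ∀ x y, (A n * (y - det2 (toC m) (toC n)) + B n) * (A m * x + B m) -
        (A m * (x + det2 (toC m) (toC n)) + B m) * (A n * y + B n) =
          -det2 (toC m) (toC n) * (A (m + n) * (x + y) + B (m + n)) := by
      intro x y
      obtain ⟨z, hx, hy⟩ := exists_det2_eq hD x y
      have := H.EE_zero m n z
      rwa [hAB m hm, hAB m hm, hAB n hn, hAB n hn, hAB _ hmn, toC_add, det2_add_right,
        det2_sub_left, det2_sub_left, hx, hy, det2_swap (toC m) (toC n), sub_neg_eq_add] at this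
    have h0 := hrel 0 0
    have h1 := hrel 1 0
    constructor
    · exact mul_left_cancel₀ hD (by linear_combination h1 - h0)
    · exact mul_left_cancel₀ hD (by linear_combination h0)
  have hA : ∀ m, m ≠ 0 → A m ≠ 0 := by
    intro m hm h
    obtain ⟨n, hn⟩ := exists_forall_ne_zero [fun n => det2 (toC n) (toC m)] (by
      simpa using isAff_of_eq (toC m) 0 (.inl (toC_ne_zero hm)) (by simp))
    simp only [List.forall_mem_cons, List.not_mem_nil, false_imp_iff, implies_true,
      and_true] at hn
    have hD : det2 (toC m) (toC n) ≠ 0 := by rwa [det2_swap, neg_ne_zero]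
    have hD' : det2 (toC m) (toC (m + n)) ≠ 0 := by
      rwa [toC_add, det2_add_right, det2_self, zero_add]
    obtain ⟨a1, -⟩ := hmulAB m n hD
    obtain ⟨a2, b2⟩ := hmulAB m (m + n) hD'
    rw [h, zero_mul] at a1 a2
    rw [h, a1, zero_mul, zero_mul, zero_add] at b2
    have hmn := (ne_zero_of_det2_toC hD').2.2
    refine H.E_ne_zero hne hmn (MvPolynomial.funext fun z => ?_)
    rw [hAB _ hmn, a2, b2, map_zero]
    ring
  -- the pairs `(A, B / A)` form a homomorphism to `ℂˣ × ℂ`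
  set f : (Fin 2 → ℤ) → ℂˣ × Multiplicative ℂ := fun m =>
    if h : m ≠ 0 then (Units.mk0 (A m) (hA m h), Multiplicative.ofAdd (B m / A m)) else 1 with hf
  have hfm : ∀ m, (h : m ≠ 0) →
      f m = (Units.mk0 (A m) (hA m h), Multiplicative.ofAdd (B m / A m)) := fun m h => dif_pos h
  have hfmul : ∀ m n, det2 (toC m) (toC n) ≠ 0 → f (m + n) = f m * f n := by
    intro m n hD
    obtain ⟨hm, hn, hmn⟩ := ne_zero_of_det2_toC hD
    obtain ⟨h1, h2⟩ := hmulAB m n hD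
    have hAm := hA m hm
    have hAn := hA n hn
    rw [hfm m hm, hfm n hn, hfm _ hmn]
    refine Prod.ext (Units.ext h1) ?_
    change Multiplicative.ofAdd _ = Multiplicative.ofAdd _ * Multiplicative.ofAdd _
    rw [← ofAdd_add, h2, h1]
    congr 1
    field_simp
  obtain ⟨x, y, hxy⟩ := exists_character (Good := fun m => m ≠ 0) (f := f) (r := 0) (t := 0)
    (fun m n hm hn hmn => by
      obtain ⟨k, hk⟩ := exists_forall_ne_zero
        [fun k => det2 (toC k) (toC n), fun k => det2 (toC (n + k)) (toC m),
          fun k => det2 (toC k) (toC (m + n))] (by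
        simp only [List.forall_mem_cons, List.not_mem_nil, false_imp_iff, implies_true, and_true]
        exact ⟨isAff_of_eq (toC n) 0 (.inl (toC_ne_zero hn)) (by simp),
          isAff_of_eq (toC m) (det2 (toC n) (toC m)) (.inl (toC_ne_zero hm)) fun k => by
            rw [toC_add, det2_add_left, add_comm],
          isAff_of_eq (toC (m + n)) 0 (.inl (toC_ne_zero hmn)) (by simp)⟩)
      simp only [List.forall_mem_cons, List.not_mem_nil, false_imp_iff, implies_true,
        and_true] at hk
      obtain ⟨k1, k2, k3⟩ := hk
      have e1 := hfmul n k (by rwa [det2_swap, neg_ne_zero])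
      have e2 := hfmul m (n + k) (by rwa [det2_swap, neg_ne_zero])
      have e3 := hfmul (m + n) k (by rwa [det2_swap, neg_ne_zero])
      rw [add_assoc, e2, e1, ← mul_assoc] at e3
      exact (mul_right_cancel e3).symm)
    (fun m hm => by
      obtain ⟨k, hk⟩ := exists_forall_ne_zero [fun k => det2 (toC k) (toC m)] (by
        simpa using isAff_of_eq (toC m) 0 (.inl (toC_ne_zero hm)) (by simp))
      simp only [List.forall_mem_cons, List.not_mem_nil, false_imp_iff, implies_true,
        and_true] at hk
      have e1 := hfmul m k (by rwa [det2_swap, neg_ne_zero])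
      have e2 := hfmul (-m) (m + k) (by
        rw [toC_neg, toC_add, det2_neg_left, det2_add_right, det2_self, zero_add, det2_swap,
          neg_neg]
        exact hk)
      rw [neg_add_cancel_left, e1, ← mul_assoc] at e2
      exact eq_inv_of_mul_eq_one_left (mul_eq_right.1 e2.symm))
    (fun m hm => hm) (by simp)
    (fun i hi h => hi (by simpa using congrFun h 0))
    (fun i hi h => hi (by simpa using congrFun h 1))
  refine ⟨![x.1, y.1], ![Multiplicative.toAdd y.2, -Multiplicative.toAdd x.2], fun m z => ?_⟩
  rcases eq_or_ne m 0 with rfl | hm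
  · rw [H.zero, toC_zero]
    simp [det2]
  have h := hxy m hm
  rw [hfm m hm] at h
  have h1 : A m = lamPow ![x.1, y.1] m := by
    have := congrArg (fun g => ((Prod.fst g : ℂˣ) : ℂ)) h
    simpa [lamPow] using this
  have h2 : B m / A m = m 0 * Multiplicative.toAdd x.2 + m 1 * Multiplicative.toAdd y.2 := by
    have := congrArg (fun g => Multiplicative.toAdd (Prod.snd g)) h
    simpa using this
  have hAm := hA m hm
  rw [div_eq_iff hAm] at h2
  rw [hAB m hm, h2, ← h1]
  simp [det2, toC]
  ring

/-! ### Case `p = 0`: the polynomials `c_m` -/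

/-- If `|m, n| = 0`, then `E(n)` and `t^m` commute, so that `c_m` is invariant under translation in
the direction `n`. -/
theorem OpRel.t_invariant (H : OpRel 0 e c) {lam : Fin 2 → ℂˣ} {β : Fin 2 → ℂ}
    (he : ∀ m z, MvPolynomial.eval z (e m) = lamPow lam m * det2 (z + β) (toC m))
    {m n : Fin 2 → ℤ} (hn : n ≠ 0) (hmn : det2 (toC m) (toC n) = 0) (z : Fin 2 → ℂ) :
    MvPolynomial.eval (z - toC n) (c m) = MvPolynomial.eval z (c m) := by
  suffices h : (shift (toC n) (c m) - c m) * linPoly (toC n) β = 0 by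
    have h0 := (mul_eq_zero.1 h).resolve_right (fun h0 => by
      obtain ⟨q, hq⟩ := exists_det2_eq_one (toC_ne_zero hn)
      have := congrArg (MvPolynomial.eval (q - β)) h0
      simp only [linPoly, map_sub, map_mul, map_add, MvPolynomial.eval_C, MvPolynomial.eval_X,
        Pi.sub_apply, sub_add_cancel, map_zero] at this
      refine one_ne_zero (α := ℂ) ?_
      rw [← hq, ← this, det2]
      ring)
    have := congrArg (MvPolynomial.eval z) h0
    rw [map_sub, eval_shift, map_zero] at this
    exact sub_eq_zero.1 this
  refine MvPolynomial.funext fun z => ?_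
  have h1 := H.tE m n z
  have h2 : MvPolynomial.eval z (linPoly (toC n) β) = det2 (z + β) (toC n) := by
    simp only [linPoly, map_sub, map_mul, map_add, MvPolynomial.eval_C, MvPolynomial.eval_X, det2,
      Pi.add_apply]
    ring
  rw [add_zero, add_zero, hmn, he, he, sub_add_eq_add_sub, det2_sub_left, hmn, sub_zero,
    neg_zero, zero_mul] at h1
  rw [map_mul, map_sub, eval_shift, h2, map_zero]
  exact mul_left_cancel₀ (lamPow_ne_zero lam n) (by linear_combination -h1)

/-- If `p = 0`, the polynomials `c_m` are the constants of `Ω(λ, β, b, k)`. The vector `0` is separate,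
as `t^0` is not a bracket. -/
theorem OpRel.exists_form_t_zero (H : OpRel 0 e c) {lam : Fin 2 → ℂˣ} {β : Fin 2 → ℂ}
    (he : ∀ m z, MvPolynomial.eval z (e m) = lamPow lam m * det2 (z + β) (toC m)) :
    ∃ b k, (∀ z, MvPolynomial.eval z (c 0) = b) ∧
      ∀ m, m ≠ 0 → ∀ z, MvPolynomial.eval z (c m) = lamPow lam m * k := by
  have hQ : ∀ m, ∃ Q : Polynomial ℂ, m ≠ 0 → ∀ z,
      MvPolynomial.eval z (c m) = lamPow lam m * Q.eval (det2 z (toC m)) := by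
    intro m
    by_cases hm : m = 0
    · exact ⟨0, fun h => absurd hm h⟩
    · obtain ⟨P, hP⟩ := exists_eval_eq_of_invariant (toC_ne_zero hm)
        (H.t_invariant he hm (det2_self _))
      refine ⟨Polynomial.C (lamPow lam m)⁻¹ * P, fun _ z => ?_⟩
      rw [hP, Polynomial.eval_mul, Polynomial.eval_C, mul_inv_cancel_left₀ (lamPow_ne_zero lam m)]
  choose Q hQ using hQ
  -- the brackets of `t^m` and `E(n)` for linearly independent `m`, `n`
  have hrel : ∀ m n, det2 (toC m) (toC n) ≠ 0 → ∀ x y,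
      (y + det2 β (toC n)) * ((Q m).eval x - (Q m).eval (x + det2 (toC m) (toC n))) -
        det2 (toC m) (toC n) * (Q m).eval x =
          -det2 (toC m) (toC n) * (Q (m + n)).eval (x + y) := by
    intro m n hD x y
    obtain ⟨hm, hn, hmn⟩ := ne_zero_of_det2_toC hD
    obtain ⟨z, hx, hy⟩ := exists_det2_eq hD x y
    have := H.tE m n z
    rw [he, he, hQ m hm, hQ m hm, hQ _ hmn, toC_add, lamPow_add] at this
    simp only [det2_sub_left, det2_add_left, det2_add_right, hx, hy, add_zero,
      det2_swap (toC m) (toC n), sub_neg_eq_add] at this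
    refine mul_left_cancel₀ (mul_ne_zero (lamPow_ne_zero lam m) (lamPow_ne_zero lam n)) ?_
    linear_combination this
  have haff : ∀ m, ∃ A B, m ≠ 0 → ∀ x, (Q m).eval x = A * x + B := by
    intro m
    by_cases hm : m = 0
    · exact ⟨0, 0, fun h => absurd hm h⟩
    obtain ⟨k, hk⟩ := exists_forall_ne_zero [fun k => det2 (toC k) (toC m)] (by
      simpa using isAff_of_eq (toC m) 0 (.inl (toC_ne_zero hm)) (by simp))
    simp only [List.forall_mem_cons, List.not_mem_nil, false_imp_iff, implies_true,
      and_true] at hk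
    have hD : det2 (toC k) (toC (m - k)) ≠ 0 := by
      rwa [sub_eq_add_neg, toC_add, toC_neg, det2_add_right, det2_neg_right, det2_self, neg_zero,
        add_zero]
    have h := hrel k (m - k) hD 0
    rw [add_sub_cancel] at h
    set D := det2 (toC k) (toC (m - k))
    refine ⟨-(((Q k).eval 0 - (Q k).eval (0 + D)) / D),
      -(det2 β (toC (m - k)) * ((Q k).eval 0 - (Q k).eval (0 + D)) / D) + (Q k).eval 0,
      fun _ y => ?_⟩
    have := h y
    rw [zero_add y] at this
    field_simp
    linear_combination this
  choose A B hAB using haff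
  have hstep : ∀ m n, det2 (toC m) (toC n) ≠ 0 →
      A (m + n) = A m ∧ B (m + n) = B m + det2 β (toC n) * A m := by
    intro m n hD
    obtain ⟨hm, hn, hmn⟩ := ne_zero_of_det2_toC hD
    have h0 := hrel m n hD 0 0
    have h1 := hrel m n hD 1 0
    simp only [hAB m hm, hAB _ hmn] at h0 h1
    constructor
    · exact mul_left_cancel₀ hD (by linear_combination h1 - h0)
    · exact mul_left_cancel₀ hD (by linear_combination h0)
  -- the operators `t^m` and `t^{m+n}` commute only if the slope is zero
  have hA : ∀ m, m ≠ 0 → A m = 0 := by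
    intro m hm
    obtain ⟨n, hn⟩ := exists_forall_ne_zero [fun n => det2 (toC n) (toC m)] (by
      simpa using isAff_of_eq (toC m) 0 (.inl (toC_ne_zero hm)) (by simp))
    simp only [List.forall_mem_cons, List.not_mem_nil, false_imp_iff, implies_true,
      and_true] at hn
    have hD : det2 (toC m) (toC n) ≠ 0 := by rwa [det2_swap, neg_ne_zero]
    have hD' : det2 (toC m) (toC (m + n)) ≠ 0 := by
      rwa [toC_add, det2_add_right, det2_self, zero_add]
    have hmn := (ne_zero_of_det2_toC hD).2.2
    have htt : ∀ x y, (Q (m + n)).eval (y - det2 (toC m) (toC (m + n))) * (Q m).eval x =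
        (Q m).eval (x + det2 (toC m) (toC (m + n))) * (Q (m + n)).eval y := by
      intro x y
      obtain ⟨z, hx, hy⟩ := exists_det2_eq hD' x y
      have := H.tt m (m + n) z
      rw [add_zero, add_zero, hQ m hm, hQ m hm, hQ _ hmn, hQ _ hmn, det2_sub_left, det2_sub_left,
        hx, hy, det2_swap (toC m) (toC (m + n)), sub_neg_eq_add] at this
      refine mul_left_cancel₀ (mul_ne_zero (lamPow_ne_zero lam m) (lamPow_ne_zero lam (m + n))) ?_
      linear_combination this
    have h0 := htt 0 0
    have h1 := htt 1 0
    simp only [hAB m hm, hAB _ hmn, (hstep m n hD).1] at h0 h1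
    have : det2 (toC m) (toC (m + n)) * (A m * A m) = 0 := by linear_combination h0 - h1
    exact mul_self_eq_zero.1 ((mul_eq_zero.1 this).resolve_left hD')
  have hB : ∀ m n, det2 (toC m) (toC n) ≠ 0 → B n = B m := by
    intro m n hD
    have := (hstep m (n - m) (by
      rwa [sub_eq_add_neg, toC_add, toC_neg, det2_add_right, det2_neg_right, det2_self, neg_zero,
        add_zero])).2
    rwa [hA m (ne_zero_of_det2_toC hD).1, mul_zero, add_zero, add_sub_cancel] at this
  have he1 : (![1, 0] : Fin 2 → ℤ) ≠ 0 := fun h => by simpa using congrFun h 0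
  have he2 : (![0, 1] : Fin 2 → ℤ) ≠ 0 := fun h => by simpa using congrFun h 1
  refine ⟨MvPolynomial.eval 0 (c 0), B ![1, 0], fun z => ?_, fun m hm z => ?_⟩
  · have h0 : ∀ n, n ≠ 0 → ∀ z,
        MvPolynomial.eval (z - toC n) (c 0) = MvPolynomial.eval z (c 0) := fun n hn =>
      H.t_invariant he hn (by simp [toC_zero, det2])
    obtain ⟨P, hP⟩ := exists_eval_eq_of_invariant (toC_ne_zero he1) (h0 _ he1)
    have hper := eval_eq_of_periodic (P := P) one_ne_zero (fun s => by
      have h1 := h0 _ he2 ![0, -s]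
      rw [hP, hP] at h1
      simpa [det2, toC, add_comm] using h1)
    rw [hP, hP, hper]
    simp [det2]
  · obtain ⟨k, hk⟩ := exists_forall_ne_zero
      [fun k => det2 (toC k) (toC m), fun k => det2 (toC k) (toC ![1, 0])] (by
      simp only [List.forall_mem_cons, List.not_mem_nil, false_imp_iff, implies_true, and_true]
      exact ⟨isAff_of_eq (toC m) 0 (.inl (toC_ne_zero hm)) (by simp),
        isAff_of_eq (toC ![1, 0]) 0 (.inl (toC_ne_zero he1)) (by simp)⟩)
    simp only [List.forall_mem_cons, List.not_mem_nil, false_imp_iff, implies_true,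
      and_true] at hk
    rw [hQ m hm, hAB m hm, hA m hm, hB k m hk.1, ← hB k _ hk.2, zero_mul, zero_add]

end zero

/-! ### From modules to polynomials -/

theorem UhFreeRankOne.exists_linearEquiv {V : Type*} [AddCommGroup V] [Module ℂ V]
    {D : Fin 2 → Module.End ℂ V} (h : UhFreeRankOne D) :
    ∃ φ : V ≃ₗ[ℂ] Uh, ∀ i v, φ (D i v) = MvPolynomial.X i * φ v := by
  obtain ⟨_, hC, hX, _, hrank⟩ := h
  have : Module.Finite Uh V := Module.finite_of_finrank_pos (by omega)
  let ψ : V ≃ₗ[Uh] Uh := LinearEquiv.ofFinrankEq V Uh (by rw [hrank, Module.finrank_self])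
  refine ⟨{ ψ with
    map_smul' := fun a v => ?_ }, fun i v => ?_⟩
  · change ψ (a • v) = a • ψ v
    rw [← hC, map_smul, smul_eq_mul, MvPolynomial.smul_eq_C_mul]
  · change ψ (D i v) = MvPolynomial.X i * ψ v
    rw [← hX, map_smul, smul_eq_mul]

/-- An operator on `ℂ[∂₁, ∂₂]` that has weight `a` under `∂₁` and `∂₂` is determined by its value
at `1`. -/
theorem apply_eq_mul_shift {T : Module.End ℂ Uh} {a : Fin 2 → ℂ}
    (h : ∀ i f, MvPolynomial.X i * T f - T (MvPolynomial.X i * f) = a i • T f) (f : Uh) :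
    T f = T 1 * shift a f := by
  induction f using MvPolynomial.induction_on with
  | C x =>
    rw [shift_C, MvPolynomial.C_eq_smul_one, map_smul, mul_smul_comm, mul_one]
  | add f g hf hg => rw [map_add, map_add, mul_add, hf, hg]
  | mul_X f i hf =>
    have h1 := h i f
    have hs : shift a (MvPolynomial.X i) = MvPolynomial.X i - MvPolynomial.C (a i) := by
      simp [shift]
    rw [mul_comm f, map_mul (shift a), hs]
    rw [MvPolynomial.smul_eq_C_mul] at h1
    rw [hf] at h1
    linear_combination -h1

/-- Operators `E(m)`, `t^m`, `∂ᵢ` on a vector space that satisfy the relations of `L̃(p)`. -/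
structure IsRep (p : Fin 2 → ℂ) {V : Type*} [AddCommGroup V] [Module ℂ V]
    (D : Fin 2 → Module.End ℂ V) (E T : (Fin 2 → ℤ) → Module.End ℂ V) : Prop where
  EE : ∀ m n v, E m (E n v) - E n (E m v) = (-det2 (toC m + p) (toC n + p)) • E (m + n) v
  tE : ∀ m n v, T m (E n v) - E n (T m v) = (-det2 (toC m + p) (toC n + p)) • T (m + n) v
  tt : ∀ m n v, T m (T n v) - T n (T m v) = 0
  dE : ∀ i m v, D i (E m v) - E m (D i v) = (m i : ℂ) • E m v
  dt : ∀ i m v, D i (T m v) - T m (D i v) = ((m i : ℂ) + p i) • T m v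
  zero : ∀ v, E 0 v = p 1 • D 0 v - p 0 • D 1 v

theorem IsRep.exists_opRel {p : Fin 2 → ℂ} {V : Type*} [AddCommGroup V] [Module ℂ V]
    {D : Fin 2 → Module.End ℂ V} {E T : (Fin 2 → ℤ) → Module.End ℂ V} (H : IsRep p D E T)
    (h : UhFreeRankOne D) :
    ∃ (φ : V ≃ₗ[ℂ] Uh) (e c : (Fin 2 → ℤ) → Uh), OpRel p e c ∧
      (∀ i v, φ (D i v) = MvPolynomial.X i * φ v) ∧
      (∀ m v, φ (E m v) = e m * shift (toC m) (φ v)) ∧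
      ∀ m v, φ (T m v) = c m * shift (toC m + p) (φ v) := by
  obtain ⟨φ, hφ⟩ := h.exists_linearEquiv
  have hE : ∀ m v, φ (E m v) = φ (E m (φ.symm 1)) * shift (toC m) (φ v) := by
    intro m v
    have := apply_eq_mul_shift (T := φ.conj (E m)) (a := toC m) (fun i f => by
      have := congrArg φ (H.dE i m (φ.symm f))
      simp only [LinearEquiv.conj_apply_apply]
      rw [map_sub, hφ, map_smul] at this
      rwa [show φ.symm (MvPolynomial.X i * f) = D i (φ.symm f) by
        rw [LinearEquiv.symm_apply_eq, hφ, LinearEquiv.apply_symm_apply]]) (φ v)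
    simpa only [LinearEquiv.conj_apply_apply, LinearEquiv.symm_apply_apply] using this
  have hT : ∀ m v, φ (T m v) = φ (T m (φ.symm 1)) * shift (toC m + p) (φ v) := by
    intro m v
    have := apply_eq_mul_shift (T := φ.conj (T m)) (a := toC m + p) (fun i f => by
      have := congrArg φ (H.dt i m (φ.symm f))
      simp only [LinearEquiv.conj_apply_apply]
      rw [map_sub, hφ, map_smul] at this
      rwa [show φ.symm (MvPolynomial.X i * f) = D i (φ.symm f) by
        rw [LinearEquiv.symm_apply_eq, hφ, LinearEquiv.apply_symm_apply]]) (φ v)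
    simpa only [LinearEquiv.conj_apply_apply, LinearEquiv.symm_apply_apply] using this
  refine ⟨φ, fun m => φ (E m (φ.symm 1)), fun m => φ (T m (φ.symm 1)), ⟨?_, ?_, ?_, ?_⟩, hφ, hE,
    hT⟩
  · intro m n z
    have := congrArg (fun v => MvPolynomial.eval z (φ v)) (H.EE m n (φ.symm 1))
    simp only [map_sub, map_smul, MvPolynomial.smul_eval] at this
    rw [hE m (E n _), hE n (E m _)] at this
    simp only [map_mul, eval_shift] at this
    linear_combination this
  · intro m n z
    have := congrArg (fun v => MvPolynomial.eval z (φ v)) (H.tE m n (φ.symm 1))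
    simp only [map_sub, map_smul, MvPolynomial.smul_eval] at this
    rw [hT m (E n _), hE n (T m _)] at this
    simp only [map_mul, eval_shift] at this
    linear_combination this
  · intro m n z
    have := congrArg (fun v => MvPolynomial.eval z (φ v)) (H.tt m n (φ.symm 1))
    simp only [map_sub, map_zero] at this
    rw [hT m (T n _), hT n (T m _)] at this
    simp only [map_mul, eval_shift] at this
    linear_combination this
  · intro z
    simp only [H.zero, map_sub, map_smul, hφ, LinearEquiv.apply_symm_apply, mul_one,
      MvPolynomial.smul_eval, MvPolynomial.eval_X, det2]
    ring

/-- A representation by operators on a space that is free of rank one over `ℂ[∂₁, ∂₂]` is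
equivalent to `Ω(λ, α, b)` if `p ≠ 0`. -/
theorem IsRep.exists_omegaOp {p : Fin 2 → ℂ} (hp : p ≠ 0) {V : Type*} [AddCommGroup V] [Module ℂ V]
    {D : Fin 2 → Module.End ℂ V} {E T : (Fin 2 → ℤ) → Module.End ℂ V} (H : IsRep p D E T)
    (h : UhFreeRankOne D) :
    ∃ (lam : Fin 2 → ℂˣ) (α b : ℂ) (φ : V ≃ₗ[ℂ] Uh),
      (∀ i v, φ (D i v) = omegaOp p lam α b (Gen.d i) (φ v)) ∧
      (∀ m v, φ (E m v) = omegaOp p lam α b (Gen.E m) (φ v)) ∧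
      ∀ m v, φ (T m v) = omegaOp p lam α b (Gen.t m) (φ v) := by
  obtain ⟨φ, e, c, hrel, hD, hE, hT⟩ := H.exists_opRel h
  obtain ⟨lam, α, he⟩ := hrel.exists_form hp
  obtain ⟨b, hc⟩ := hrel.exists_form_t hp he
  refine ⟨lam, α, b, φ, hD, fun m v => ?_, fun m v => ?_⟩
  · rw [hE]
    refine congrArg (· * _) (MvPolynomial.funext fun z => ?_)
    simp only [he, det2, linPoly, map_mul, map_sub, map_add, MvPolynomial.eval_C,
      MvPolynomial.eval_X, Pi.add_apply]
    ring
  · rw [hT]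
    refine congrArg (· * _) (MvPolynomial.funext fun z => ?_)
    rw [hc, MvPolynomial.eval_C]

/-- A representation by operators on a space that is free of rank one over `ℂ[∂₁, ∂₂]` is
equivalent to `Ω(λ, β, b, k)` if `p = 0` and not all `E(m)` are zero. -/
theorem IsRep.exists_omegaZeroOp {V : Type*} [AddCommGroup V] [Module ℂ V]
    {D : Fin 2 → Module.End ℂ V} {E T : (Fin 2 → ℤ) → Module.End ℂ V} (H : IsRep 0 D E T)
    (h : UhFreeRankOne D) (hne : ∃ m v, E m v ≠ 0) :
    ∃ (lam : Fin 2 → ℂˣ) (β : Fin 2 → ℂ) (b k : ℂ) (φ : V ≃ₗ[ℂ] Uh),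
      (∀ i v, φ (D i v) = omegaZeroOp lam β b k (Gen.d i) (φ v)) ∧
      (∀ m v, φ (E m v) = omegaZeroOp lam β b k (Gen.E m) (φ v)) ∧
      ∀ m v, φ (T m v) = omegaZeroOp lam β b k (Gen.t m) (φ v) := by
  obtain ⟨φ, e, c, hrel, hD, hE, hT⟩ := H.exists_opRel h
  obtain ⟨lam, β, he⟩ := hrel.exists_form_zero (by
    obtain ⟨m, v, hmv⟩ := hne
    refine ⟨m, fun h0 => hmv (φ.injective ?_)⟩
    rw [hE, h0, zero_mul, map_zero])
  obtain ⟨b, k, hb, hk⟩ := hrel.exists_form_t_zero he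
  refine ⟨lam, β, b, k, φ, hD, fun m v => ?_, fun m v => ?_⟩
  · rw [hE]
    refine congrArg (· * _) (MvPolynomial.funext fun z => ?_)
    simp only [he, det2, linPoly, map_mul, map_sub, map_add, MvPolynomial.eval_C,
      MvPolynomial.eval_X, Pi.add_apply]
    ring
  · rw [hT, add_zero]
    by_cases hm : m = 0
    · subst hm
      rw [show omegaZeroOp lam β b k (Gen.t 0) = mulShift (MvPolynomial.C b) 0 by simp [omegaZeroOp],
        mulShift_apply, toC_zero]
      refine congrArg (· * _) (MvPolynomial.funext fun z => ?_)
      rw [hb, MvPolynomial.eval_C]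
    · rw [show omegaZeroOp lam β b k (Gen.t m) =
        mulShift (MvPolynomial.C (lamPow lam m * k)) (toC m) from if_neg hm, mulShift_apply]
      refine congrArg (· * _) (MvPolynomial.funext fun z => ?_)
      rw [hk m hm, MvPolynomial.eval_C]

/-! ### The relations in `L̃(p)` and `L(p)`, and equivariance -/

section Modules

variable {p : Fin 2 → ℂ}

theorem mk_eq_of_rel {x y : FreeLieAlgebra ℂ Gen} (h : Rel p x y) :
    (LieSubmodule.Quotient.mk x : Ltilde p) = LieSubmodule.Quotient.mk y := by
  refine (Submodule.Quotient.eq _).2 ?_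
  exact LieSubmodule.subset_lieSpan ⟨x, y, h, rfl⟩

theorem lie_tElt_tElt (m n : Fin 2 → ℤ) : ⁅tElt p m, tElt p n⁆ = 0 := mk_eq_of_rel (Rel.tt m n)

theorem lie_tElt_EElt (m n : Fin 2 → ℤ) :
    ⁅tElt p m, EElt p n⁆ = (-det2 (toC m + p) (toC n + p)) • tElt p (m + n) :=
  mk_eq_of_rel (Rel.tE m n)

theorem lie_EElt_EElt (m n : Fin 2 → ℤ) :
    ⁅EElt p m, EElt p n⁆ = (-det2 (toC m + p) (toC n + p)) • EElt p (m + n) :=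
  mk_eq_of_rel (Rel.EE m n)

theorem lie_dElt_EElt (i : Fin 2) (m : Fin 2 → ℤ) :
    ⁅dElt p i, EElt p m⁆ = (m i : ℂ) • EElt p m :=
  mk_eq_of_rel (Rel.dE i m)

theorem lie_dElt_tElt (i : Fin 2) (m : Fin 2 → ℤ) :
    ⁅dElt p i, tElt p m⁆ = ((m i : ℂ) + p i) • tElt p m :=
  mk_eq_of_rel (Rel.dt i m)

theorem EElt_zero : EElt p 0 = p 1 • dElt p 0 - p 0 • dElt p 1 := mk_eq_of_rel Rel.E_zero

theorem isRep_of_Ltilde (V : Type*) [AddCommGroup V] [Module ℂ V] [LieRingModule (Ltilde p) V]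
    [LieModule ℂ (Ltilde p) V] :
    IsRep p (fun i => LieModule.toEnd ℂ (Ltilde p) V (dElt p i))
      (fun m => LieModule.toEnd ℂ (Ltilde p) V (EElt p m))
      (fun m => LieModule.toEnd ℂ (Ltilde p) V (tElt p m)) where
  EE m n v := by
    simp only [LieModule.toEnd_apply_apply]
    rw [← lie_lie, lie_EElt_EElt, smul_lie]
  tE m n v := by
    simp only [LieModule.toEnd_apply_apply]
    rw [← lie_lie, lie_tElt_EElt, smul_lie]
  tt m n v := by
    simp only [LieModule.toEnd_apply_apply]
    rw [← lie_lie, lie_tElt_tElt, zero_lie]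
  dE i m v := by
    simp only [LieModule.toEnd_apply_apply]
    rw [← lie_lie, lie_dElt_EElt, smul_lie]
  dt i m v := by
    simp only [LieModule.toEnd_apply_apply]
    rw [← lie_lie, lie_dElt_tElt, smul_lie]
  zero v := by
    simp only [LieModule.toEnd_apply_apply]
    rw [EElt_zero, sub_lie, smul_lie, smul_lie]

theorem HAction.isRep {V : Type*} [AddCommGroup V] [Module ℂ V] [LieRingModule (Lalg p) V]
    [LieModule ℂ (Lalg p) V] {D : Fin 2 → Module.End ℂ V} (H : HAction p D) :
    IsRep p D (fun m => LieModule.toEnd ℂ (Lalg p) V (EL p m))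
      (fun m => LieModule.toEnd ℂ (Lalg p) V (tL p m)) where
  EE m n v := by
    simp only [LieModule.toEnd_apply_apply]
    rw [← lie_lie, ← smul_lie]
    exact congrArg (⁅·, v⁆) (Subtype.ext (lie_EElt_EElt m n))
  tE m n v := by
    simp only [LieModule.toEnd_apply_apply]
    rw [← lie_lie, ← smul_lie]
    exact congrArg (⁅·, v⁆) (Subtype.ext (lie_tElt_EElt m n))
  tt m n v := by
    simp only [LieModule.toEnd_apply_apply]
    rw [← lie_lie, ← zero_lie (L := Lalg p) v]
    exact congrArg (⁅·, v⁆) (Subtype.ext (lie_tElt_tElt m n))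
  dE := H.lie_E
  dt := H.lie_t
  zero := H.E_zero

/-- A linear map between `L̃(p)`-modules is equivariant if it commutes with the generators. -/
theorem map_lie_of_generators {V W : Type*} [AddCommGroup V] [Module ℂ V]
    [LieRingModule (Ltilde p) V] [LieModule ℂ (Ltilde p) V] [AddCommGroup W] [Module ℂ W]
    [LieRingModule (Ltilde p) W] [LieModule ℂ (Ltilde p) W] (φ : V →ₗ[ℂ] W)
    (h : ∀ (g : Gen) v, φ ⁅(LieSubmodule.Quotient.mk (FreeLieAlgebra.of ℂ g) : Ltilde p), v⁆ =
      ⁅(LieSubmodule.Quotient.mk (FreeLieAlgebra.of ℂ g) : Ltilde p), φ v⁆)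
    (x : Ltilde p) (v : V) : φ ⁅x, v⁆ = ⁅x, φ v⁆ := by
  let S : LieSubalgebra ℂ (Ltilde p) :=
    { carrier := {x | ∀ v, φ ⁅x, v⁆ = ⁅x, φ v⁆}
      add_mem' := fun {x y} hx hy v => by rw [add_lie, add_lie, map_add, hx, hy]
      zero_mem' := fun v => by rw [zero_lie, zero_lie, map_zero]
      smul_mem' := fun a x hx v => by rw [smul_lie, smul_lie, map_smul, hx]
      lie_mem' := fun {x y} hx hy v => by
        rw [lie_lie, lie_lie, map_sub, hx, hy, hy, hx] }
  let mkHom : FreeLieAlgebra ℂ Gen →ₗ⁅ℂ⁆ Ltilde p :=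
    { (relIdeal p).toSubmodule.mkQ with map_lie' := rfl }
  have hS : ∀ y, mkHom y ∈ S := by
    intro y
    have : S.incl.comp (FreeLieAlgebra.lift ℂ fun g => (⟨mkHom (FreeLieAlgebra.of ℂ g), h g⟩ : S)) =
        mkHom := FreeLieAlgebra.hom_ext fun g => by
      rw [LieHom.comp_apply, FreeLieAlgebra.lift_of_apply]
      rfl
    rw [← this]
    exact Subtype.property _
  induction x using Submodule.Quotient.induction_on with | _ x =>
  exact hS x v

/-- A linear map between `L(p)`-modules is equivariant if it commutes with all `t^m` and `E(m)`. -/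
theorem map_lie_of_generators_Lalg {V W : Type*} [AddCommGroup V] [Module ℂ V]
    [LieRingModule (Lalg p) V] [LieModule ℂ (Lalg p) V] [AddCommGroup W] [Module ℂ W]
    [LieRingModule (Lalg p) W] [LieModule ℂ (Lalg p) W] (φ : V →ₗ[ℂ] W)
    (ht : ∀ m v, φ ⁅tL p m, v⁆ = ⁅tL p m, φ v⁆) (hE : ∀ m v, φ ⁅EL p m, v⁆ = ⁅EL p m, φ v⁆)
    (x : Lalg p) (v : V) : φ ⁅x, v⁆ = ⁅x, φ v⁆ := by
  obtain ⟨x, hx⟩ := x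
  revert v
  refine LieSubalgebra.lieSpan_induction (R := ℂ)
    (p := fun x hx => ∀ v, φ ⁅(⟨x, hx⟩ : Lalg p), v⁆ = ⁅(⟨x, hx⟩ : Lalg p), φ v⁆)
    ?_ ?_ ?_ ?_ ?_ hx
  · rintro _ (⟨m, rfl⟩ | ⟨m, rfl⟩)
    · exact ht m
    · exact hE m
  · intro v
    change φ ⁅(0 : Lalg p), v⁆ = ⁅(0 : Lalg p), φ v⁆
    rw [zero_lie, zero_lie, map_zero]
  · intro x y hx hy h1 h2 v
    change φ ⁅(⟨x, hx⟩ + ⟨y, hy⟩ : Lalg p), v⁆ = ⁅(⟨x, hx⟩ + ⟨y, hy⟩ : Lalg p), φ v⁆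
    rw [add_lie, add_lie, map_add, h1, h2]
  · intro a x hx h1 v
    change φ ⁅(a • ⟨x, hx⟩ : Lalg p), v⁆ = ⁅(a • ⟨x, hx⟩ : Lalg p), φ v⁆
    rw [smul_lie, smul_lie, map_smul, h1]
  · intro x y hx hy h1 h2 v
    change φ ⁅⁅(⟨x, hx⟩ : Lalg p), (⟨y, hy⟩ : Lalg p)⁆, v⁆ =
      ⁅⁅(⟨x, hx⟩ : Lalg p), (⟨y, hy⟩ : Lalg p)⁆, φ v⁆
    rw [lie_lie, lie_lie, map_sub, h1, h2, h2, h1]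

/-- A linear equivalence that commutes with the generators, as an equivalence of
`L̃(p)`-modules. -/
def equivOfGenerators {V W : Type*} [AddCommGroup V] [Module ℂ V]
    [LieRingModule (Ltilde p) V] [LieModule ℂ (Ltilde p) V] [AddCommGroup W] [Module ℂ W]
    [LieRingModule (Ltilde p) W] [LieModule ℂ (Ltilde p) W] (φ : V ≃ₗ[ℂ] W)
    (h : ∀ (g : Gen) v, φ ⁅(LieSubmodule.Quotient.mk (FreeLieAlgebra.of ℂ g) : Ltilde p), v⁆ =
      ⁅(LieSubmodule.Quotient.mk (FreeLieAlgebra.of ℂ g) : Ltilde p), φ v⁆) :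
    V ≃ₗ⁅ℂ,Ltilde p⁆ W :=
  { φ with map_lie' := fun {x v} => map_lie_of_generators (φ : V →ₗ[ℂ] W) h x v }

/-- A linear equivalence that commutes with all `t^m` and `E(m)`, as an equivalence of
`L(p)`-modules. -/
def equivOfGeneratorsLalg {V W : Type*} [AddCommGroup V] [Module ℂ V]
    [LieRingModule (Lalg p) V] [LieModule ℂ (Lalg p) V] [AddCommGroup W] [Module ℂ W]
    [LieRingModule (Lalg p) W] [LieModule ℂ (Lalg p) W] (φ : V ≃ₗ[ℂ] W)
    (ht : ∀ m v, φ ⁅tL p m, v⁆ = ⁅tL p m, φ v⁆) (hE : ∀ m v, φ ⁅EL p m, v⁆ = ⁅EL p m, φ v⁆) :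
    V ≃ₗ⁅ℂ,Lalg p⁆ W :=
  { φ with map_lie' := fun {x v} => map_lie_of_generators_Lalg (φ : V →ₗ[ℂ] W) ht hE x v }

theorem Omega_generator (p : Fin 2 → ℂ) (lam : Fin 2 → ℂˣ) (α b : ℂ) (g : Gen) (f : Uh) :
    (⁅(LieSubmodule.Quotient.mk (FreeLieAlgebra.of ℂ g) : Ltilde p),
      (show Omega p lam α b from f)⁆ : Omega p lam α b) = (omegaOp p lam α b g f : Uh) :=
  LinearMap.congr_fun (liftL_mk p _ (omegaOp_rel p lam α b) g) f

theorem OmegaZero_generator (lam : Fin 2 → ℂˣ) (β : Fin 2 → ℂ) (b k : ℂ) (g : Gen) (f : Uh) :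
    (⁅(LieSubmodule.Quotient.mk (FreeLieAlgebra.of ℂ g) : Ltilde 0),
      (show OmegaZero lam β b k from f)⁆ : OmegaZero lam β b k) =
        (omegaZeroOp lam β b k g f : Uh) :=
  LinearMap.congr_fun (liftL_mk 0 _ (omegaZeroOp_rel lam β b k) g) f

theorem omegaOp_t_of_eq_zero {lam : Fin 2 → ℂˣ} {α b : ℂ} (hb : b = 0) (m : Fin 2 → ℤ) :
    omegaOp p lam α b (Gen.t m) = 0 := by
  rw [omegaOp, hb, mul_zero, map_zero, mulShift_zero_left]

end Modules

end HeisVir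

end

open HeisVir in
theorem mainTheorem1 :
    -- `p ≠ (0, 0)`, modules over `L̃(p)`
    (∀ p : Fin 2 → ℂ, p ≠ 0 →
      ∀ (V : Type*) [AddCommGroup V] [Module ℂ V] [LieRingModule (Ltilde p) V]
        [LieModule ℂ (Ltilde p) V],
        UhFreeRankOne (fun i => LieModule.toEnd ℂ (Ltilde p) V (dElt p i)) →
        ∃ (lam : Fin 2 → ℂˣ) (α b : ℂ),
          Nonempty (V ≃ₗ⁅ℂ,Ltilde p⁆ Omega p lam α b) ∧
          (b = 0 → ∀ (m : Fin 2 → ℤ) (v : V), ⁅tElt p m, v⁆ = 0)) ∧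
    -- `p ≠ (0, 0)`, modules over `L(p)`
    (∀ p : Fin 2 → ℂ, p ≠ 0 →
      ∀ (V : Type*) [AddCommGroup V] [Module ℂ V] [LieRingModule (Lalg p) V]
        [LieModule ℂ (Lalg p) V] (D : Fin 2 → Module.End ℂ V),
        HAction p D → UhFreeRankOne D →
        ∃ (lam : Fin 2 → ℂˣ) (α b : ℂ),
          (∃ φ : V ≃ₗ⁅ℂ,Lalg p⁆ Omega p lam α b, ∀ i v, φ (D i v) = ⁅dElt p i, φ v⁆) ∧
          (b = 0 → ∀ (m : Fin 2 → ℤ) (v : V), ⁅tL p m, v⁆ = 0)) ∧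
    -- `p = (0, 0)`, modules over `L̃(0, 0)` on which not all `E(m)` act as zero
    (∀ (V : Type*) [AddCommGroup V] [Module ℂ V] [LieRingModule (Ltilde 0) V]
        [LieModule ℂ (Ltilde 0) V],
        UhFreeRankOne (fun i => LieModule.toEnd ℂ (Ltilde 0) V (dElt 0 i)) →
        (∃ (m : Fin 2 → ℤ) (v : V), ⁅EElt 0 m, v⁆ ≠ 0) →
        ∃ (lam : Fin 2 → ℂˣ) (β : Fin 2 → ℂ) (b k : ℂ),
          Nonempty (V ≃ₗ⁅ℂ,Ltilde 0⁆ OmegaZero lam β b k)) ∧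
    -- `p = (0, 0)`, modules over `L(0, 0)` on which not all `E(m)` act as zero
    (∀ (V : Type*) [AddCommGroup V] [Module ℂ V] [LieRingModule (Lalg 0) V]
        [LieModule ℂ (Lalg 0) V] (D : Fin 2 → Module.End ℂ V),
        HAction 0 D → UhFreeRankOne D →
        (∃ (m : Fin 2 → ℤ) (v : V), ⁅EL 0 m, v⁆ ≠ 0) →
        ∃ (lam : Fin 2 → ℂˣ) (β : Fin 2 → ℂ) (b k : ℂ),
          ∃ φ : V ≃ₗ⁅ℂ,Lalg 0⁆ OmegaZero lam β b k, ∀ i v, φ (D i v) = ⁅dElt 0 i, φ v⁆) := by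
  refine ⟨?_, ?_, ?_, ?_⟩
  · intro p hp V _ _ _ _ h
    obtain ⟨lam, α, b, φ, hD, hE, hT⟩ := (isRep_of_Ltilde V).exists_omegaOp hp h
    refine ⟨lam, α, b, ⟨equivOfGenerators (W := Omega p lam α b) φ ?_⟩, fun hb m v => ?_⟩
    · rintro (m | m | i) v
      · exact (hT m v).trans (Omega_generator p lam α b (Gen.t m) _).symm
      · exact (hE m v).trans (Omega_generator p lam α b (Gen.E m) _).symm
      · exact (hD i v).trans (Omega_generator p lam α b (Gen.d i) _).symm
    · refine φ.injective ((hT m v).trans ?_)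
      rw [omegaOp_t_of_eq_zero hb, map_zero, LinearMap.zero_apply]
  · intro p hp V _ _ _ _ D H h
    obtain ⟨lam, α, b, φ, hD, hE, hT⟩ := H.isRep.exists_omegaOp hp h
    refine ⟨lam, α, b, ⟨equivOfGeneratorsLalg (W := Omega p lam α b) φ ?_ ?_, ?_⟩,
      fun hb m v => ?_⟩
    · exact fun m v => (hT m v).trans (Omega_generator p lam α b (Gen.t m) _).symm
    · exact fun m v => (hE m v).trans (Omega_generator p lam α b (Gen.E m) _).symm
    · exact fun i v => (hD i v).trans (Omega_generator p lam α b (Gen.d i) _).symm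
    · refine φ.injective ((hT m v).trans ?_)
      rw [omegaOp_t_of_eq_zero hb, map_zero, LinearMap.zero_apply]
  · intro V _ _ _ _ h hne
    obtain ⟨lam, β, b, k, φ, hD, hE, hT⟩ := (isRep_of_Ltilde V).exists_omegaZeroOp h hne
    refine ⟨lam, β, b, k, ⟨equivOfGenerators (W := OmegaZero lam β b k) φ ?_⟩⟩
    rintro (m | m | i) v
    · exact (hT m v).trans (OmegaZero_generator lam β b k (Gen.t m) _).symm
    · exact (hE m v).trans (OmegaZero_generator lam β b k (Gen.E m) _).symm
    · exact (hD i v).trans (OmegaZero_generator lam β b k (Gen.d i) _).symm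
  · intro V _ _ _ _ D H h hne
    obtain ⟨lam, β, b, k, φ, hD, hE, hT⟩ := H.isRep.exists_omegaZeroOp h hne
    refine ⟨lam, β, b, k, equivOfGeneratorsLalg (W := OmegaZero lam β b k) φ ?_ ?_, ?_⟩
    · exact fun m v => (hT m v).trans (OmegaZero_generator lam β b k (Gen.t m) _).symm
    · exact fun m v => (hE m v).trans (OmegaZero_generator lam β b k (Gen.E m) _).symm
    · exact fun i v => (hD i v).trans (OmegaZero_generator lam β b k (Gen.d i) _).symm
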